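/- **The model.** Let $A,B>0$, $0<\alpha<1$, $n\ge 0$, $0<\delta_k,\delta_h<1$, $\theta\le 1$, $0<\beta<1$, and let the size of the externality $\gamma\ge 0$ be arbitrary. Let $\phi:[0,1]\to\mathbb R_+$ be continuous and strictly increasing with $\phi(0)=0$ and $\phi(1)>\delta_h/B$; put $D_h=B\phi(1)+1-\delta_h$. Let $U(c)=(c^\theta-1)/\theta$ if $\theta\ne0$ and $U(c)=\log c$ if $\theta=0$, with $U(0)=-\infty$ if $\theta\le 0$. Given $(k_0,h_0)\in\mathbb R_+^2$, an *optimal equilibrium with externalities* is a nonnegative plan $(c_t,u_t,v_t,k_{t+1},h_{t+1})_{t\ge0}$ that maximizes $\sum_{t\ge0}\beta^tU(c_t)$ subject to $$c_t+(1+n)k_{t+1}\le Ak_t^\alpha u_t^{1-\alpha}h_t^{1-\alpha+\gamma}+(1-\delta_k)k_t,\quad h_{t+1}=[B\phi(v_t)+1-\delta_h]h_t,\quad u_t+v_t\le1 .$$ In reduced form, $\hat\Gamma(k,h)$ is the set of $(k',h')\in\mathbb R_+^2$ with $(1+n)k'\le Ak^\alpha h^{1-\alpha+\gamma}+(1-\delta_k)k$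 and $h'\le D_hh$, and $$\hat F(k,h,k',h')=U\big[\max\{0,\;Ak^\alpha\psi(h,h')^{1-\alpha}h^{1-\alpha+\gamma}+(1-\delta_k)k-(1+n)k'\}\big],$$ where $\psi(h,h')=1$ if $h=0$ or $h'\le(1-\delta_h)h$, and $\psi(h,h')=1-\phi^{-1}\big[\tfrac1B\big(\tfrac{h'}h-(1-\delta_h)\big)\big]$ if $h>0$ and $(1-\delta_h)h\le h'\le D_hh$. Let $\hat\Pi(k_0,h_0)$ be the set of sequences $(\mathbf k,\mathbf h)$ starting at $(k_0,h_0)$ with $(k_{t+1},h_{t+1})\in\hat\Gamma(k_t,h_t)$ for all $t$, let $\hat J(\mathbf k,\mathbf h)=\sum_{t\ge0}\beta^t\hat F(k_t,h_t,k_{t+1},h_{t+1})$, let $\hat\Pi'(k_0,h_0)=\{(\mathbf k,\mathbf h)\in\hat\Pi(k_0,h_0):\hat J(\mathbf k,\mathbf h)>-\infty\}$, and let $\hat V(k_0,h_0)=\sup_{\hat\Pi(k_0,h_0)}\hat J$. Let $S$ be the set of upper semicontinuous $W:\mathbb R_+^2\to\mathbb R\cup\{-\infty\}$ with $\limsup_t\beta^tW(k_t,h_t)\le0$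 along every sequence in every $\hat\Pi(k_0,h_0)$ and $\lim_t\beta^tW(k_t,h_t)=0$ along every sequence in every $\hat\Pi'(k_0,h_0)$. **Assumptions.** Fix a continuous $N:\mathbb R_+^2\to\mathbb R_+$ that measures the size of a state (for instance a norm $N(k,h)=\|k,h\|$, or $N(k,h)=k+h^{\rho}$ with $\rho=\frac{1-\alpha+\gamma}{1-\alpha}$). - (A1) $\hat\Gamma$ is a nonempty, continuous, compact-valued correspondence with $(0,0)\in\hat\Gamma(0,0)$. - (A2) There are $\zeta,\zeta'\ge0$, $\zeta\ne1$, with $N(k',h')\le\zeta N(k,h)+\zeta'$ whenever $(k',h')\in\hat\Gamma(k,h)$. - (A3) There are $\eta,\eta'\ge0$ with $\hat F(k,h,k',h')\le\eta\,(N(k,h)+N(k',h'))+\eta'$ on the graph of $\hat\Gamma$. - (A4) If $\zeta>0$ in (A2), then $\beta\zeta<1$. - (A5) On the graph of $\hat\Gamma$, $\hat F$ is continuous where it is $>-\infty$, and tends to $-\infty$ along every sequence in the graph converging to a point where $\hat F=-\infty$. - (A7) $\hat\Gamma(0,0)=\{(0,0)\}$, $\hat F(0,0,0,0)=-\infty$,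 and there is a continuous $\hat\Psi:\mathbb R_+^2\to\mathbb R\cup\{-\infty\}$ with $\hat V\ge\hat\Psi$ and $\lim_t\beta^t\hat\Psi(k_t,h_t)=0$ for all $(\mathbf k,\mathbf h)\in\hat\Pi'(k_0,h_0)$ and all $(k_0,h_0)\in\mathbb R_+^2$. **Proposition.** Assume (A1)–(A5). Then: 1. If $\theta\le0$, then (A7) holds. 2. If (A7) holds, or if $0<\theta\le1$, then: - for every $(k_0,h_0)\in\mathbb R_+^2$ there is an optimal equilibrium with externalities, and the supremum $\hat V(k_0,h_0)$ is attained on $\hat\Pi(k_0,h_0)$ (all the infinite sums above are well defined as limits of partial sums in $\mathbb R\cup\{-\infty\}$, and $\hat V<+\infty$); - $\hat V$ satisfies the Bellman equation $\hat V(k,h)=\sup\{\hat F(k,h,k',h')+\beta\hat V(k',h'):(k',h')\in\hat\Gamma(k,h)\}$ for all $(k,h)\in\mathbb R_+^2$, belongs to $S$, and is the unique solution of this equation in $S$; - $\hat V$ is continuous at every state $(k_t,h_t)$ of every $(\mathbf k,\mathbf h)\in\hat\Pi'(k_0,h_0)$, for every $(k_0,h_0)$; and if $\hat V(k_0,h_0)=-\infty$,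 then $\hat V(k_m,h_m)\to-\infty$ for every sequence $(k_m,h_m)\to(k_0,h_0)$. -/

import Mathlib

open Filter Topology
open scoped NNReal

/-! ### Discounted dynamic programs on the nonnegative quadrant -/

/-- States `(k, h)`: physical and human capital, with the topology of the quadrant. -/
abbrev State : Type := ℝ≥0 × ℝ≥0

namespace DynProg

/-- Partial sums `∑_{t < T} β ^ t r_t` of discounted extended-real returns. -/
noncomputable def partialSum (β : ℝ) (r : ℕ → EReal) (T : ℕ) : EReal :=
  ∑ t ∈ Finset.range T, ((β ^ t : ℝ) : EReal) * r t

/-- Total discounted return `∑_{t ≥ 0} β ^ t r_t`; this is the limit of the partial sums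
whenever that limit exists. -/
noncomputable def total (β : ℝ) (r : ℕ → EReal) : EReal :=
  limsup (partialSum β r) atTop

/-- The infinite discounted sum is well defined: the partial sums converge to `total`. -/
def SumExists (β : ℝ) (r : ℕ → EReal) : Prop :=
  Tendsto (partialSum β r) atTop (𝓝 (total β r))

/-- The graph of a correspondence. -/
def graph (Γ : State → Set State) : Set (State × State) :=
  {p | p.2 ∈ Γ p.1}

/-- State sequences that are feasible from `x₀`. -/
def paths (Γ : State → Set State) (x₀ : State) : Set (ℕ → State) :=
  {x | x 0 = x₀ ∧ ∀ t, x (t + 1) ∈ Γ (x t)}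

/-- The returns along a state sequence. -/
def returns (F : State × State → EReal) (x : ℕ → State) (t : ℕ) : EReal :=
  F (x t, x (t + 1))

/-- Total discounted returns along a state sequence. -/
noncomputable def J (F : State × State → EReal) (β : ℝ) (x : ℕ → State) : EReal :=
  total β (returns F x)

/-- Feasible sequences from `x₀` whose total discounted return is not `-∞`. -/
def finitePaths (Γ : State → Set State) (F : State × State → EReal) (β : ℝ) (x₀ : State) :
    Set (ℕ → State) :=
  {x | x ∈ paths Γ x₀ ∧ ⊥ < J F β x}

/-- The value function. -/
noncomputable def value (Γ : State → Set State) (F : State × State → EReal) (β : ℝ)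
    (x₀ : State) : EReal :=
  ⨆ x ∈ paths Γ x₀, J F β x

/-- (A1) `Γ` is a nonempty, continuous, compact-valued correspondence and
`(0, 0) ∈ Γ (0, 0)`. -/
structure A1 (Γ : State → Set State) : Prop where
  nonempty : ∀ x, (Γ x).Nonempty
  compact : ∀ x, IsCompact (Γ x)
  upper : UpperHemicontinuous Γ
  lower : LowerHemicontinuous Γ
  zero_mem : (0 : State) ∈ Γ 0

/-- (A2) `N (k', h') ≤ ζ N (k, h) + ζ'` on the graph of `Γ`. Here `N` measures the size of a
state; the basic choice is a norm of `(k, h)`. -/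
def A2 (Γ : State → Set State) (N : State → ℝ) (ζ ζ' : ℝ) : Prop :=
  0 ≤ ζ ∧ 0 ≤ ζ' ∧ ζ ≠ 1 ∧ ∀ x, ∀ x' ∈ Γ x, N x' ≤ ζ * N x + ζ'

/-- (A3) `F (k, h, k', h') ≤ η (N (k, h) + N (k', h')) + η'` on the graph of `Γ`, for some
constants `η, η' ≥ 0`. -/
def A3 (Γ : State → Set State) (F : State × State → EReal) (N : State → ℝ) : Prop :=
  ∃ η η' : ℝ, 0 ≤ η ∧ 0 ≤ η' ∧
    ∀ x, ∀ x' ∈ Γ x, F (x, x') ≤ ((η * (N x + N x') + η' : ℝ) : EReal)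

/-- (A4) If `ζ > 0` in (A2), then `β ζ < 1`. -/
def A4 (β ζ : ℝ) : Prop := 0 < ζ → β * ζ < 1

/-- (A5) On the graph of `Γ`, `F` is continuous wherever it is finite, and tends to `-∞` along
every sequence in the graph that converges to a point where it is `-∞`. -/
structure A5 (Γ : State → Set State) (F : State × State → EReal) : Prop where
  continuous : ∀ p ∈ graph Γ, ⊥ < F p → ContinuousWithinAt F (graph Γ) p
  tendsto_bot : ∀ p ∈ graph Γ, F p = ⊥ → ∀ q : ℕ → State × State, (∀ m, q m ∈ graph Γ) →
    Tendsto q atTop (𝓝 p) → Tendsto (fun m => F (q m)) atTop (𝓝 ⊥)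

/-- (A7) `Γ (0, 0) = {(0, 0)}`, `F (0, 0, 0, 0) = -∞`, and the value function has a continuous
minorant `Ψ` with values in `ℝ ∪ {-∞}` such that `β ^ t Ψ (k_t, h_t) → 0` along every feasible
sequence whose total discounted return is not `-∞`. -/
structure A7 (Γ : State → Set State) (F : State × State → EReal) (β : ℝ) : Prop where
  zero : Γ 0 = {0}
  return_zero : F (0, 0) = ⊥
  minorant : ∃ Ψ : State → EReal, Continuous Ψ ∧ (∀ x, Ψ x ≠ ⊤) ∧
    (∀ x, Ψ x ≤ value Γ F β x) ∧
    ∀ x₀, ∀ x ∈ finitePaths Γ F β x₀,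
      Tendsto (fun t : ℕ => ((β ^ t : ℝ) : EReal) * Ψ (x t)) atTop (𝓝 0)

/-- The space of upper semicontinuous functions with values in `ℝ ∪ {-∞}` that satisfy the
transversality conditions (S1) and (S2). -/
structure InS (Γ : State → Set State) (F : State × State → EReal) (β : ℝ)
    (W : State → EReal) : Prop where
  ne_top : ∀ x, W x ≠ ⊤
  usc : UpperSemicontinuous W
  limsup_le : ∀ x₀, ∀ x ∈ paths Γ x₀,
    limsup (fun t : ℕ => ((β ^ t : ℝ) : EReal) * W (x t)) atTop ≤ 0
  tendsto_zero : ∀ x₀, ∀ x ∈ finitePaths Γ F β x₀,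
    Tendsto (fun t : ℕ => ((β ^ t : ℝ) : EReal) * W (x t)) atTop (𝓝 0)

/-- The Bellman equation for `W`. -/
def Bellman (Γ : State → Set State) (F : State × State → EReal) (β : ℝ)
    (W : State → EReal) : Prop :=
  ∀ x, W x = ⨆ x' ∈ Γ x, F (x, x') + (β : EReal) * W x'

/-- All infinite sums are well defined, the supremum of total discounted returns is attained
from every initial state, and it is never `+∞`. -/
structure Solvable (Γ : State → Set State) (F : State × State → EReal) (β : ℝ) : Prop where
  sumExists : ∀ x₀, ∀ x ∈ paths Γ x₀, SumExists β (returns F x)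
  exists_optimal : ∀ x₀, ∃ x ∈ paths Γ x₀, J F β x = value Γ F β x₀
  value_ne_top : ∀ x₀, value Γ F β x₀ ≠ ⊤

/-- The value function satisfies the Bellman equation and is its unique solution in the
space described by `InS`. -/
structure BellmanCharacterization (Γ : State → Set State) (F : State × State → EReal)
    (β : ℝ) : Prop where
  bellman : Bellman Γ F β (value Γ F β)
  value_mem : InS Γ F β (value Γ F β)
  unique : ∀ W, InS Γ F β W → Bellman Γ F β W → W = value Γ F β

/-- The value function is continuous at every state of every feasible sequence whose total
discounted return is not `-∞`, and tends to `-∞` along every sequence of states that converges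
to a state where it is `-∞`. -/
structure ValueContinuity (Γ : State → Set State) (F : State × State → EReal)
    (β : ℝ) : Prop where
  continuousAt : ∀ x₀, ∀ x ∈ finitePaths Γ F β x₀, ∀ t, ContinuousAt (value Γ F β) (x t)
  tendsto_bot : ∀ x₀, value Γ F β x₀ = ⊥ → ∀ y : ℕ → State, Tendsto y atTop (𝓝 x₀) →
    Tendsto (fun m => value Γ F β (y m)) atTop (𝓝 ⊥)

end DynProg

/-! ### The Lucas–Uzawa model with human capital externalities -/

/-- Parameters of the model, with externality of any size `γ ≥ 0`. Only the values of `φ` on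
`[0, 1]` matter. -/
structure LucasUzawa where
  A : ℝ
  α : ℝ
  n : ℝ
  δk : ℝ
  δh : ℝ
  B : ℝ
  θ : ℝ
  β : ℝ
  γ : ℝ
  φ : ℝ → ℝ
  A_pos : 0 < A
  α_pos : 0 < α
  α_lt_one : α < 1
  n_nonneg : 0 ≤ n
  δk_pos : 0 < δk
  δk_lt_one : δk < 1
  δh_pos : 0 < δh
  δh_lt_one : δh < 1
  B_pos : 0 < B
  θ_le_one : θ ≤ 1
  β_pos : 0 < β
  β_lt_one : β < 1
  γ_nonneg : 0 ≤ γ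
  φ_continuous : ContinuousOn φ (Set.Icc 0 1)
  φ_strictMono : StrictMonoOn φ (Set.Icc 0 1)
  φ_zero : φ 0 = 0
  φ_one : δh / B < φ 1

namespace LucasUzawa

variable (M : LucasUzawa)

/-- Isoelastic utility: `(c ^ θ - 1) / θ` for `θ ≠ 0`, `log c` for `θ = 0`, with value `-∞`
at `c = 0` when `θ ≤ 0`. -/
noncomputable def U (c : ℝ≥0) : EReal :=
  if c = 0 ∧ M.θ ≤ 0 then ⊥
  else if M.θ = 0 then ((Real.log c : ℝ) : EReal)
  else ((((c : ℝ) ^ M.θ - 1) / M.θ : ℝ) : EReal)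

/-- The maximum growth factor of human capital in one period. -/
noncomputable def Dh : ℝ := M.B * M.φ 1 + (1 - M.δh)

/-- The inverse of `φ : [0, 1] → [0, φ 1]`. -/
noncomputable def φinv : ℝ → ℝ := Function.invFunOn M.φ (Set.Icc 0 1)

/-- The time left for market activities when human capital goes from `h` to `h'`, where
`h' ≤ Dh * h`. -/
noncomputable def ψ (h h' : ℝ≥0) : ℝ :=
  if h = 0 ∨ (h' : ℝ) ≤ (1 - M.δh) * h then 1
  else 1 - M.φinv ((1 / M.B) * ((h' : ℝ) / h - (1 - M.δh)))

/-- The feasibility correspondence of the model with externalities. -/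
def Γhat (x : State) : Set State :=
  {x' | (x'.1 : ℝ) ≤ (M.A * (x.1 : ℝ) ^ M.α * (x.2 : ℝ) ^ (1 - M.α + M.γ)
            + (1 - M.δk) * x.1) / (1 + M.n) ∧
        (x'.2 : ℝ) ≤ M.Dh * x.2}

/-- Consumption as a function of the current and the next state. It can be negative on the graph
of `Γhat`. If `k = 0` or `h = 0`, its first term vanishes. -/
noncomputable def fhat (p : State × State) : ℝ :=
  M.A * (p.1.1 : ℝ) ^ M.α * M.ψ p.1.2 p.2.2 ^ (1 - M.α) * (p.1.2 : ℝ) ^ (1 - M.α + M.γ)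
    + (1 - M.δk) * p.1.1 - (1 + M.n) * p.2.1

/-- The return function of the model with externalities: the utility of `max 0 fhat`. -/
noncomputable def Fhat (p : State × State) : EReal := M.U (M.fhat p).toNNReal

/-- If `k = 0` or `h = 0`, the return is the utility of `max 0 ((1 - δk) k - (1 + n) k')`. -/
theorem Fhat_of_zero (p : State × State) (hp : p.1.1 = 0 ∨ p.1.2 = 0) :
    M.Fhat p = M.U ((1 - M.δk) * p.1.1 - (1 + M.n) * p.2.1 : ℝ).toNNReal := by
  have h1 := M.α_pos
  have h2 := M.α_lt_one
  have h3 := M.γ_nonneg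
  have h4 : 1 - M.α + M.γ ≠ 0 := by linarith
  rcases hp with hp | hp <;> simp [Fhat, fhat, hp, Real.zero_rpow h1.ne', Real.zero_rpow h4]

/-- A plan of the social planner: consumption, time in market activities, time in human capital
accumulation, and states (all nonnegative). -/
structure Plan where
  c : ℕ → ℝ≥0
  u : ℕ → ℝ≥0
  v : ℕ → ℝ≥0
  k : ℕ → ℝ≥0
  h : ℕ → ℝ≥0

/-- Feasibility of a plan from `x₀`, with the average level of human capital equal to `h_t`. -/
structure Feasible (x₀ : State) (P : Plan) : Prop where
  init_k : P.k 0 = x₀.1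
  init_h : P.h 0 = x₀.2
  resource : ∀ t, (P.c t : ℝ) + (1 + M.n) * P.k (t + 1) ≤
    M.A * (P.k t : ℝ) ^ M.α * (P.u t : ℝ) ^ (1 - M.α) * (P.h t : ℝ) ^ (1 - M.α + M.γ)
      + (1 - M.δk) * P.k t
  human : ∀ t, (P.h (t + 1) : ℝ) = (M.B * M.φ (P.v t) + (1 - M.δh)) * P.h t
  time : ∀ t, P.u t + P.v t ≤ 1

/-- The utilities along a plan. -/
noncomputable def utilities (P : Plan) (t : ℕ) : EReal := M.U (P.c t)

/-- An optimal equilibrium with externalities: a solution of the planner's problem of maximizing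
`∑ β ^ t U (c_t)` over feasible plans. -/
def OptimalEquilibrium (x₀ : State) (P : Plan) : Prop :=
  M.Feasible x₀ P ∧ ∀ Q, M.Feasible x₀ Q →
    DynProg.total M.β (M.utilities Q) ≤ DynProg.total M.β (M.utilities P)

/-- An optimal equilibrium with externalities exists from every initial state, in the original
variables and in the reduced form in terms of the states only, the value function is characterized
by the Bellman equation, and it is continuous. -/
structure Conclusions : Prop where
  sumExists : ∀ x₀ P, M.Feasible x₀ P → DynProg.SumExists M.β (M.utilities P)
  exists_equilibrium : ∀ x₀, ∃ P, M.OptimalEquilibrium x₀ P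
  solvable : DynProg.Solvable M.Γhat M.Fhat M.β
  bellman : DynProg.BellmanCharacterization M.Γhat M.Fhat M.β
  continuity : DynProg.ValueContinuity M.Γhat M.Fhat M.β

end LucasUzawa

/-!
The heart of the matter is that the value function `V` of the reduced form is continuous for every
utility exponent `θ`; then `V` itself is a continuous minorant as required in `DynProg.A7`, and the
two cases of the second claim need not be told apart.

*Upper semicontinuity and the Bellman equation.* By `A2`, `A3`, `A4` the returns along all paths
that start in a compact set `K` of states are bounded above by one discounted-summable sequence.
Adding the tails of this sequence to the partial sums makes them decreasing, so total returns are
well defined, and they are an infimum of functions of the path that are continuous by `A5`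
(`DynProg.upperSemicontinuousOn_total`). The paths from `K` form a compact set in the product
topology, because an upper hemicontinuous compact-valued correspondence has a closed graph and maps
compact sets to compact sets (`DynProg.Regular.isCompact_pathsFrom`). Hence optimal paths exist,
and the superlevel sets of `V` over `K` are projections of compact sets. The Bellman equation
follows by splitting off the first period. The bound on returns shows that the upper limit of the
discounted values along a path is at most zero, and along paths with finite total return these
values are also bounded below by the tails of the total. Any solution `W` in the same space is at
most `V` (follow a policy that attains the supremum in the equation for `W`) and at least `V`
(iterate the inequality along a path with finite total return).

*Lower semicontinuity.* With `ρ = (1 - α + γ) / (1 - α)`, the map `(k, h) ↦ (μ ^ ρ k, μ h)` sends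
feasible paths to feasible paths and multiplies consumption by `μ ^ ρ`, so it acts on total
discounted utility by an affine map that tends to the identity as `μ → 1`. Moreover, a larger
current state allows the same next states, with at least the same consumption. States near `(k, h)`
with `k > 0` dominate the scaled `(k, h)` for `μ < 1`, so that `V` cannot jump down
(`LucasUzawa.J_scale_le_value`). If `k = 0`, consumption is zero forever and `V` is minimal.

*Optimal plans.* The reduced form allows physical capital to be accumulated beyond what is
compatible with the choice of human capital (consumption is then replaced by zero), so for `θ > 0`
an optimal path of the reduced form need not come from a plan. Therefore plans without waste are
shown to form a compact set on their own, on which total utility is upper semicontinuous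
(`LucasUzawa.exists_optimalEquilibrium`); every feasible plan is dominated by one without waste,
and its utilities are bounded by the returns of the reduced form along its states.
-/

namespace DynProg

/-! ### Discounted sums of extended-real returns -/

theorem coe_mul_add (a : ℝ) (ha : 0 ≤ a) (x y : EReal) :
    (a : EReal) * (x + y) = a * x + a * y :=
  EReal.left_distrib_of_nonneg_of_ne_top (by exact_mod_cast ha) (EReal.coe_ne_top a) x y

theorem coe_mul_ne_top {a : ℝ} (ha : 0 < a) {x : EReal} (hx : x ≠ ⊤) : (a : EReal) * x ≠ ⊤ := by
  induction x with
  | bot => simp [EReal.coe_mul_bot_of_pos ha]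
  | coe x => exact_mod_cast EReal.coe_ne_top (a * x)
  | top => exact absurd rfl hx

theorem coe_mul_mono {a : ℝ} (ha : 0 ≤ a) {x y : EReal} (h : x ≤ y) :
    (a : EReal) * x ≤ a * y :=
  mul_le_mul_of_nonneg_left h (by exact_mod_cast ha)

theorem ne_top_of_le_coe {x : EReal} {a : ℝ} (h : x ≤ a) : x ≠ ⊤ :=
  (h.trans_lt (EReal.coe_lt_top a)).ne

theorem continuousOn_add_ereal {X : Type*} [TopologicalSpace X] {K : Set X} {f g : X → EReal}
    (hf : ContinuousOn f K) (hg : ContinuousOn g K) (hf' : ∀ x ∈ K, f x ≠ ⊤)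
    (hg' : ∀ x ∈ K, g x ≠ ⊤) : ContinuousOn (fun x => f x + g x) K := by
  intro x hx
  have h := EReal.continuousAt_add (p := (f x, g x)) (Or.inl (hf' x hx)) (Or.inr (hg' x hx))
  exact h.tendsto.comp ((hf x hx).tendsto.prodMk_nhds (hg x hx).tendsto)

theorem continuousOn_coe_mul_ereal {X : Type*} [TopologicalSpace X] {K : Set X} {f : X → EReal}
    (hf : ContinuousOn f K) (a : ℝ) :
    ContinuousOn (fun x => (a : EReal) * f x) K := fun x hx =>
  EReal.Tendsto.const_mul (hf x hx).tendsto (Or.inl (EReal.coe_ne_bot a))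
    (Or.inl (EReal.coe_ne_top a))

variable {β : ℝ}

@[simp] theorem partialSum_zero (r : ℕ → EReal) : partialSum β r 0 = 0 := by simp [partialSum]

theorem partialSum_succ (r : ℕ → EReal) (T : ℕ) :
    partialSum β r (T + 1) = partialSum β r T + ((β ^ T : ℝ) : EReal) * r T := by
  simp [partialSum, Finset.sum_range_succ]

theorem partialSum_add (hβ : 0 ≤ β) (r : ℕ → EReal) (T n : ℕ) :
    partialSum β r (T + n) =
      partialSum β r T + ((β ^ T : ℝ) : EReal) * partialSum β (fun t => r (T + t)) n := by
  induction n with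
  | zero => simp
  | succ n ih =>
    rw [← add_assoc, partialSum_succ, ih, partialSum_succ, coe_mul_add _ (pow_nonneg hβ T),
      pow_add, EReal.coe_mul, mul_assoc, add_assoc]

theorem partialSum_ne_top (hβ : 0 < β) {r : ℕ → EReal} (hr : ∀ t, r t ≠ ⊤) (T : ℕ) :
    partialSum β r T ≠ ⊤ := by
  induction T with
  | zero => simp
  | succ T ih =>
    rw [partialSum_succ]
    exact (EReal.add_lt_top ih (coe_mul_ne_top (pow_pos hβ T) (hr T))).ne

theorem partialSum_mono (hβ : 0 ≤ β) {r s : ℕ → EReal} (h : ∀ t, r t ≤ s t) (T : ℕ) :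
    partialSum β r T ≤ partialSum β s T :=
  Finset.sum_le_sum fun t _ => coe_mul_mono (pow_nonneg hβ t) (h t)

theorem partialSum_coe (b : ℕ → ℝ) (T : ℕ) :
    partialSum β (fun t => (b t : EReal)) T =
      ((∑ t ∈ Finset.range T, β ^ t * b t : ℝ) : EReal) := by
  induction T with
  | zero => simp
  | succ T ih => rw [partialSum_succ, ih, Finset.sum_range_succ]; push_cast; rfl

theorem total_mono (hβ : 0 ≤ β) {r s : ℕ → EReal} (h : ∀ t, r t ≤ s t) :
    total β r ≤ total β s :=
  limsup_le_limsup (Eventually.of_forall (partialSum_mono hβ h))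

theorem total_eq_of_tendsto {r : ℕ → EReal} {a : EReal}
    (h : Tendsto (partialSum β r) atTop (𝓝 a)) : total β r = a := h.limsup_eq

theorem SumExists.of_tendsto {r : ℕ → EReal} {a : EReal}
    (h : Tendsto (partialSum β r) atTop (𝓝 a)) : SumExists β r := by
  rw [SumExists, total_eq_of_tendsto h]; exact h

theorem tendsto_partialSum_coe {b : ℕ → ℝ} (hb : Summable fun t => β ^ t * b t) :
    Tendsto (partialSum β fun t => (b t : EReal)) atTop
      (𝓝 ((∑' t, β ^ t * b t : ℝ) : EReal)) := by
  simp_rw [funext (partialSum_coe (β := β) b)]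
  exact EReal.tendsto_coe.2 hb.hasSum.tendsto_sum_nat

/-- The tail `∑_{t ≥ T} β ^ t b_t` of a real discounted series. -/
noncomputable def tail (β : ℝ) (b : ℕ → ℝ) (T : ℕ) : ℝ := ∑' t, β ^ (t + T) * b (t + T)

theorem tail_succ {b : ℕ → ℝ} (hb : Summable fun t => β ^ t * b t) (T : ℕ) :
    tail β b T = β ^ T * b T + tail β b (T + 1) := by
  have h := ((summable_nat_add_iff T).2 hb).tsum_eq_zero_add
  simp only [tail, h, zero_add]
  congr 2; ext t; rw [add_right_comm, add_assoc]

theorem tendsto_tail (b : ℕ → ℝ) : Tendsto (tail β b) atTop (𝓝 0) :=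
  tendsto_sum_nat_add fun t => β ^ t * b t

/-- If the returns are bounded above by a discounted-summable real sequence, then adding the tail
of the bound to the partial sums makes them decreasing, so that their limit is an infimum. -/
theorem tendsto_partialSum (hβ : 0 ≤ β) {r : ℕ → EReal} {b : ℕ → ℝ}
    (hb : Summable fun t => β ^ t * b t) (hr : ∀ t, r t ≤ b t) :
    Tendsto (partialSum β r) atTop (𝓝 (⨅ T, partialSum β r T + (tail β b T : EReal))) := by
  have hanti : Antitone fun T => partialSum β r T + (tail β b T : EReal) := by
    refine antitone_nat_of_succ_le fun T => ?_
    rw [partialSum_succ, tail_succ hb T, EReal.coe_add, add_assoc]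
    gcongr
    rw [EReal.coe_mul]
    exact coe_mul_mono (pow_nonneg hβ T) (hr T)
  have h1 := tendsto_atTop_iInf hanti
  have h2 : Tendsto (fun T => ((-tail β b T : ℝ) : EReal)) atTop (𝓝 ((0 : ℝ) : EReal)) :=
    EReal.tendsto_coe.2 (by simpa using (tendsto_tail (β := β) b).neg)
  have h3 := (EReal.continuousAt_add (p := (⨅ T, partialSum β r T + (tail β b T : EReal),
    ((0 : ℝ) : EReal))) (by simp) (by simp)).tendsto.comp (h1.prodMk_nhds h2)
  simp only [EReal.coe_zero, add_zero] at h3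
  refine h3.congr fun T => ?_
  simp only [Function.comp]
  rw [add_assoc, ← EReal.coe_add]; simp

theorem sumExists_of_le (hβ : 0 ≤ β) {r : ℕ → EReal} {b : ℕ → ℝ}
    (hb : Summable fun t => β ^ t * b t) (hr : ∀ t, r t ≤ b t) : SumExists β r :=
  .of_tendsto (tendsto_partialSum hβ hb hr)

theorem total_eq_iInf (hβ : 0 ≤ β) {r : ℕ → EReal} {b : ℕ → ℝ}
    (hb : Summable fun t => β ^ t * b t) (hr : ∀ t, r t ≤ b t) :
    total β r = ⨅ T, partialSum β r T + (tail β b T : EReal) :=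
  total_eq_of_tendsto (tendsto_partialSum hβ hb hr)

theorem total_le_tsum (hβ : 0 ≤ β) {r : ℕ → EReal} {b : ℕ → ℝ}
    (hb : Summable fun t => β ^ t * b t) (hr : ∀ t, r t ≤ b t) :
    total β r ≤ ((∑' t, β ^ t * b t : ℝ) : EReal) :=
  (total_mono hβ hr).trans_eq (total_eq_of_tendsto (tendsto_partialSum_coe hb))

/-- Splitting off the first `T` terms of a discounted sum. -/
theorem total_eq_add (hβ : 0 < β) {r : ℕ → EReal} {b : ℕ → ℝ}
    (hb : Summable fun t => β ^ t * b t) (hr : ∀ t, r t ≤ b t) (T : ℕ) :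
    total β r =
      partialSum β r T + ((β ^ T : ℝ) : EReal) * total β (fun t => r (T + t)) := by
  have hT : (β ^ T) ≠ 0 := (pow_pos hβ T).ne'
  have hb' : Summable fun t => β ^ t * b (T + t) := by
    have h := (((summable_nat_add_iff T).2 hb).mul_left (β ^ T)⁻¹)
    refine h.congr fun t => ?_
    rw [pow_add, add_comm T t]; field_simp
  have h1 : Tendsto (fun n => partialSum β r (T + n)) atTop (𝓝 (total β r)) := by
    have := (tendsto_add_atTop_iff_nat T).2 (sumExists_of_le hβ.le hb hr)
    simpa only [add_comm] using this
  have h2 := sumExists_of_le hβ.le hb' (fun t => hr (T + t))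
  have hlt := ne_top_of_le_coe (total_le_tsum hβ.le hb' (fun t => hr (T + t)))
  have h3 := EReal.Tendsto.const_mul (a := ((β ^ T : ℝ) : EReal)) h2
    (Or.inl (EReal.coe_ne_bot _)) (Or.inl (EReal.coe_ne_top _))
  have h4 := (EReal.continuousAt_add (p := (partialSum β r T,
    ((β ^ T : ℝ) : EReal) * total β (fun t => r (T + t))))
    (Or.inl (partialSum_ne_top hβ (fun t => ne_top_of_le_coe (hr t)) T))
    (Or.inr (coe_mul_ne_top (pow_pos hβ T) hlt))).tendsto.comp
    (tendsto_const_nhds.prodMk_nhds h3)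
  refine tendsto_nhds_unique h1 (h4.congr fun n => ?_)
  simp only [Function.comp]
  rw [partialSum_add hβ.le]

/-- A partial sum equal to `-∞` forces the whole discounted sum to be `-∞`. -/
theorem partialSum_ne_bot (hβ : 0 < β) {r : ℕ → EReal} {b : ℕ → ℝ}
    (hb : Summable fun t => β ^ t * b t) (hr : ∀ t, r t ≤ b t) (h : ⊥ < total β r) (T : ℕ) :
    partialSum β r T ≠ ⊥ := by
  intro h0
  rw [total_eq_add hβ hb hr T, h0, EReal.bot_add] at h
  exact lt_irrefl _ h

theorem continuousOn_partialSum (hβ : 0 < β) {X : Type*} [TopologicalSpace X] {K : Set X}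
    {r : ℕ → X → EReal} (hc : ∀ t, ContinuousOn (r t) K) (ht : ∀ t, ∀ x ∈ K, r t x ≠ ⊤) (T : ℕ) :
    ContinuousOn (fun x => partialSum β (fun t => r t x) T) K := by
  induction T with
  | zero => simpa using continuousOn_const
  | succ T ih =>
    simp_rw [partialSum_succ]
    exact continuousOn_add_ereal ih (continuousOn_coe_mul_ereal (hc T) _)
      (fun x hx => partialSum_ne_top hβ (fun t => ht t x hx) T)
      (fun x hx => coe_mul_ne_top (pow_pos hβ T) (ht T x hx))

/-- A discounted sum of continuous returns with a uniform discounted-summable upper bound is upper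
semicontinuous, being an infimum of continuous functions. -/
theorem upperSemicontinuousOn_total (hβ : 0 < β) {X : Type*} [TopologicalSpace X] {K : Set X}
    {r : ℕ → X → EReal} (hc : ∀ t, ContinuousOn (r t) K) {b : ℕ → ℝ}
    (hb : Summable fun t => β ^ t * b t) (hr : ∀ t, ∀ x ∈ K, r t x ≤ b t) :
    UpperSemicontinuousOn (fun x => total β (fun t => r t x)) K := by
  have h : UpperSemicontinuousOn
      (fun x => ⨅ T, partialSum β (fun t => r t x) T + (tail β b T : EReal)) K := by
    refine upperSemicontinuousOn_iInf fun T => ContinuousOn.upperSemicontinuousOn ?_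
    exact continuousOn_add_ereal
      (continuousOn_partialSum hβ hc (fun t x hx => ne_top_of_le_coe (hr t x hx)) T)
      continuousOn_const
      (fun x hx => partialSum_ne_top hβ (fun t => ne_top_of_le_coe (hr t x hx)) T)
      (fun x _ => EReal.coe_ne_top _)
  have heq : ∀ x ∈ K, total β (fun t => r t x) = _ := fun x hx =>
    total_eq_iInf hβ.le hb fun t => hr t x hx
  intro x hx a ha
  dsimp only at ha
  rw [heq x hx] at ha
  filter_upwards [h x hx a ha, self_mem_nhdsWithin] with y hy hyK
  rwa [heq y hyK]

/-- Discounted sums of affine transforms of returns. -/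
theorem total_affine (hβ0 : 0 ≤ β) (hβ1 : β < 1) {r : ℕ → EReal} (hr : SumExists β r)
    {a : ℝ} (ha : 0 ≤ a) (c : ℝ) :
    total β (fun t => (a : EReal) * r t + c) =
      (a : EReal) * total β r + ((c * (1 - β)⁻¹ : ℝ) : EReal) := by
  have hps : ∀ T, partialSum β (fun t => (a : EReal) * r t + c) T =
      a * partialSum β r T + ((∑ t ∈ Finset.range T, β ^ t * c : ℝ) : EReal) := by
    intro T
    induction T with
    | zero => simp
    | succ T ih =>
      rw [partialSum_succ, partialSum_succ, ih, Finset.sum_range_succ, coe_mul_add _ ha,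
        coe_mul_add _ (pow_nonneg hβ0 T), EReal.coe_add, EReal.coe_mul _ c,
        mul_left_comm (a : EReal)]
      abel
  have h1 : Tendsto (fun T => ((∑ t ∈ Finset.range T, β ^ t * c : ℝ) : EReal)) atTop
      (𝓝 ((c * (1 - β)⁻¹ : ℝ) : EReal)) := by
    have h := ((hasSum_geometric_of_lt_one hβ0 hβ1).mul_right c).tendsto_sum_nat
    rw [mul_comm] at h
    exact EReal.tendsto_coe.2 h
  have h2 := EReal.Tendsto.const_mul (a := (a : EReal)) hr (Or.inl (EReal.coe_ne_bot _))
    (Or.inl (EReal.coe_ne_top _))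
  have h3 := (EReal.continuousAt_add (p := ((a : EReal) * total β r,
    ((c * (1 - β)⁻¹ : ℝ) : EReal))) (Or.inr (EReal.coe_ne_bot _))
    (Or.inr (EReal.coe_ne_top _))).tendsto.comp (h2.prodMk_nhds h1)
  exact total_eq_of_tendsto (h3.congr fun T => (hps T).symm)

end DynProg

/-! ### Dynamic programs with continuous returns -/

/-- The image of a compact set under an upper hemicontinuous, compact-valued correspondence is
compact. -/
theorem UpperHemicontinuous.isCompact_biUnion {X Y : Type*} [TopologicalSpace X]
    [TopologicalSpace Y] {Γ : X → Set Y} (hΓ : UpperHemicontinuous Γ)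
    (hc : ∀ x, IsCompact (Γ x)) {K : Set X} (hK : IsCompact K) :
    IsCompact (⋃ x ∈ K, Γ x) := by
  classical
  refine isCompact_of_finite_subcover fun {ι} U hU hcov => ?_
  refine hK.induction_on (p := fun s => ∃ t : Finset ι, ⋃ x ∈ s, Γ x ⊆ ⋃ i ∈ t, U i)
    ⟨∅, by simp⟩ ?_ ?_ ?_
  · rintro s t hst ⟨u, hu⟩
    exact ⟨u, (Set.biUnion_subset_biUnion_left hst).trans hu⟩
  · rintro s t ⟨u, hu⟩ ⟨v, hv⟩
    refine ⟨u ∪ v, ?_⟩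
    rw [Set.biUnion_union, Finset.set_biUnion_union]
    exact Set.union_subset_union hu hv
  · intro x hx
    obtain ⟨t, ht⟩ := (hc x).elim_finite_subcover U hU
      ((Set.subset_biUnion_of_mem (u := Γ) hx).trans hcov)
    have h := upperHemicontinuous_iff_forall_isOpen.1 hΓ x _
      (isOpen_biUnion fun i _ => hU i) ht
    exact ⟨_, mem_nhdsWithin_of_mem_nhds h, t, Set.iUnion₂_subset fun y hy => hy⟩

namespace DynProg

/-- The consequences of `A1`, …, `A5` on which the analysis of the dynamic program rests. The
returns along a path whose initial state has size at most `ν` are bounded by the discounted-summable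
sequence `b ν`, and these bounds are compatible with a shift of time. -/
structure Regular (Γ : State → Set State) (F : State × State → EReal) (β : ℝ) (N : State → ℝ)
    (b : ℝ → ℕ → ℝ) : Prop where
  β_pos : 0 < β
  nonempty : ∀ x, (Γ x).Nonempty
  compact : ∀ x, IsCompact (Γ x)
  upper : UpperHemicontinuous Γ
  continuousOn : ContinuousOn F (graph Γ)
  size_continuous : Continuous N
  summable : ∀ ν, Summable fun t => β ^ t * b ν t
  le_bound : ∀ ν (x : ℕ → State), (∀ t, x (t + 1) ∈ Γ (x t)) → N (x 0) ≤ ν →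
    ∀ t, F (x t, x (t + 1)) ≤ b ν t
  shift : ∀ ν T, ∃ ν', (∀ x : ℕ → State, (∀ t, x (t + 1) ∈ Γ (x t)) → N (x 0) ≤ ν →
    N (x T) ≤ ν') ∧ ∀ t, b ν' t = b ν (T + t)

/-- The bound on the size of the state after `t` periods when the initial size is `ν`. -/
def sizeBound (ζ ζ' ν : ℝ) (t : ℕ) : ℝ := (fun a => ζ * a + ζ')^[t] ν

theorem sizeBound_succ (ζ ζ' ν : ℝ) (t : ℕ) :
    sizeBound ζ ζ' ν (t + 1) = ζ * sizeBound ζ ζ' ν t + ζ' :=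
  Function.iterate_succ_apply' _ _ _

theorem sizeBound_sizeBound (ζ ζ' ν : ℝ) (T t : ℕ) :
    sizeBound ζ ζ' (sizeBound ζ ζ' ν T) t = sizeBound ζ ζ' ν (T + t) := by
  simp only [sizeBound, ← Function.iterate_add_apply, add_comm]

theorem sizeBound_eq {ζ : ℝ} (hζ : ζ ≠ 1) (ζ' ν : ℝ) (t : ℕ) :
    sizeBound ζ ζ' ν t = ζ ^ t * (ν - ζ' / (1 - ζ)) + ζ' / (1 - ζ) := by
  have h : 1 - ζ ≠ 0 := sub_ne_zero.2 hζ.symm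
  induction t with
  | zero => simp [sizeBound]
  | succ t ih => rw [sizeBound_succ, ih]; field_simp; ring

theorem summable_sizeBound {β ζ : ℝ} (hβ0 : 0 ≤ β) (hβ1 : β < 1) (hζ0 : 0 ≤ ζ) (hζ : ζ ≠ 1)
    (hβζ : β * ζ < 1) (ζ' ν : ℝ) : Summable fun t => β ^ t * sizeBound ζ ζ' ν t := by
  have h1 := (summable_geometric_of_lt_one (mul_nonneg hβ0 hζ0) hβζ).mul_right
    (ν - ζ' / (1 - ζ))
  have h2 := (summable_geometric_of_lt_one hβ0 hβ1).mul_right (ζ' / (1 - ζ))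
  refine (h1.add h2).congr fun t => ?_
  rw [sizeBound_eq hζ, mul_pow]; ring

theorem size_le_sizeBound {Γ : State → Set State} {N : State → ℝ} {ζ ζ' ν : ℝ}
    (hA2 : A2 Γ N ζ ζ') {x : ℕ → State} (hx : ∀ t, x (t + 1) ∈ Γ (x t)) (h0 : N (x 0) ≤ ν)
    (t : ℕ) : N (x t) ≤ sizeBound ζ ζ' ν t := by
  induction t with
  | zero => simpa [sizeBound] using h0
  | succ t ih =>
    rw [sizeBound_succ]
    have h1 := hA2.2.2.2 _ _ (hx t)
    have h2 := mul_le_mul_of_nonneg_left ih hA2.1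
    linarith

/-- Continuity of the return at points where it is finite, and divergence along sequences where it
is `-∞`, amount to continuity as an extended-real function. -/
theorem A5.continuousOn {Γ : State → Set State} {F : State × State → EReal} (h : A5 Γ F) :
    ContinuousOn F (graph Γ) := by
  classical
  intro p hp
  rcases eq_or_lt_of_le (bot_le (a := F p)) with hF | hF
  · rw [ContinuousWithinAt, ← hF]
    -- `tendsto_bot` needs sequences that stay in the graph, so terms outside are replaced by `p`.
    refine tendsto_of_seq_tendsto fun q hq => ?_
    rw [tendsto_nhdsWithin_iff] at hq
    have h1 := h.tendsto_bot p hp hF.symm (fun m => if q m ∈ graph Γ then q m else p)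
      (fun m => by split_ifs with hm <;> assumption)
      (hq.1.congr' (hq.2.mono fun m hm => (if_pos hm).symm))
    exact h1.congr' (hq.2.mono fun m hm => congrArg F (if_pos hm))
  · exact h.continuous p hp hF

theorem exists_regular {Γ : State → Set State} {F : State × State → EReal} {β : ℝ}
    {N : State → ℝ} {ζ ζ' : ℝ} (hβ0 : 0 < β) (hβ1 : β < 1) (hN : Continuous N) (hA1 : A1 Γ)
    (hA2 : A2 Γ N ζ ζ') (hA3 : A3 Γ F N) (hA4 : A4 β ζ) (hA5 : A5 Γ F) :
    ∃ b, Regular Γ F β N b := by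
  obtain ⟨η, η', hη, hη', hF⟩ := hA3
  have hβζ : β * ζ < 1 := by
    rcases hA2.1.eq_or_lt with h | h
    · simp [← h]
    · exact hA4 h
  have hs := summable_sizeBound hβ0.le hβ1 hA2.1 hA2.2.2.1 hβζ ζ'
  refine ⟨fun ν t => η * (sizeBound ζ ζ' ν t + sizeBound ζ ζ' ν (t + 1)) + η',
    hβ0, hA1.nonempty, hA1.compact, hA1.upper, hA5.continuousOn, hN, fun ν => ?_,
    fun ν x hx h0 t => ?_, fun ν T => ⟨sizeBound ζ ζ' ν T, fun x hx h0 => ?_, fun t => ?_⟩⟩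
  · have h1 := ((hs ν).mul_left (η * (1 + ζ))).add
      ((summable_geometric_of_lt_one hβ0.le hβ1).mul_right (η * ζ' + η'))
    refine h1.congr fun t => ?_
    rw [sizeBound_succ]; ring
  · refine (hF _ _ (hx t)).trans (EReal.coe_le_coe_iff.2 ?_)
    have h1 := size_le_sizeBound hA2 hx h0 t
    have h2 := size_le_sizeBound hA2 hx h0 (t + 1)
    gcongr
  · exact size_le_sizeBound hA2 hx h0 T
  · simp only [sizeBound_sizeBound, add_assoc]

/-- The states that can be reached from `K` in `t` periods. -/
def reach (Γ : State → Set State) (K : Set State) : ℕ → Set State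
  | 0 => K
  | t + 1 => ⋃ x ∈ reach Γ K t, Γ x

/-- Feasible sequences that start in `K`. -/
def pathsFrom (Γ : State → Set State) (K : Set State) : Set (ℕ → State) :=
  {x | x 0 ∈ K ∧ ∀ t, x (t + 1) ∈ Γ (x t)}

theorem mem_reach {Γ : State → Set State} {K : Set State} {x : ℕ → State}
    (hx : x ∈ pathsFrom Γ K) (t : ℕ) : x t ∈ reach Γ K t := by
  induction t with
  | zero => exact hx.1
  | succ t ih => exact Set.mem_biUnion ih (hx.2 t)

/-- The path that moves from `x₀` to the initial state of `y` and then follows `y`. -/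
def consPath (x₀ : State) (y : ℕ → State) : ℕ → State
  | 0 => x₀
  | t + 1 => y t

theorem J_le_value {Γ : State → Set State} {F : State × State → EReal} {β : ℝ}
    {x₀ : State} {x : ℕ → State} (hx : x ∈ paths Γ x₀) :
    J F β x ≤ value Γ F β x₀ :=
  le_iSup₂ (f := fun x (_ : x ∈ paths Γ x₀) => J F β x) x hx

theorem consPath_mem {Γ : State → Set State} {x y : State} (h : y ∈ Γ x) {z : ℕ → State}
    (hz : z ∈ paths Γ y) :
    consPath x z ∈ paths Γ x := by
  refine ⟨rfl, ?_⟩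
  rintro (_ | t)
  · rwa [← hz.1] at h
  · exact hz.2 t

theorem shift_mem {Γ : State → Set State} {x₀ : State} {x : ℕ → State} (hx : x ∈ paths Γ x₀)
    (T : ℕ) :
    (fun t => x (T + t)) ∈ paths Γ (x T) := ⟨rfl, fun t => hx.2 (T + t)⟩

namespace Regular

variable {Γ : State → Set State} {F : State × State → EReal} {β : ℝ} {N : State → ℝ}
  {b : ℝ → ℕ → ℝ}

theorem isCompact_reach (R : Regular Γ F β N b) {K : Set State} (hK : IsCompact K) (t : ℕ) :
    IsCompact (reach Γ K t) := by
  induction t with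
  | zero => exact hK
  | succ t ih => exact R.upper.isCompact_biUnion R.compact ih

theorem isClosed_graph (R : Regular Γ F β N b) : IsClosed (graph Γ) := by
  refine isClosed_of_closure_subset fun p hp => ?_
  have := mem_closure_iff_nhdsWithin_neBot.1 hp
  refine UpperHemicontinuousAt.mem_of_tendsto (l := 𝓝[graph Γ] p)
    (R.upper.upperHemicontinuousAt p.1) (R.compact p.1).isClosed
    (x := Prod.fst) (y := Prod.snd) ?_ ?_ ?_
  · exact continuous_fst.continuousAt.tendsto.mono_left nhdsWithin_le_nhds
  · exact (eventually_mem_nhdsWithin (a := p) (s := graph Γ)).frequently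
  · exact continuous_snd.continuousAt.tendsto.mono_left nhdsWithin_le_nhds

theorem isCompact_pathsFrom (R : Regular Γ F β N b) {K : Set State} (hK : IsCompact K) :
    IsCompact (pathsFrom Γ K) := by
  refine (isCompact_univ_pi fun t => R.isCompact_reach hK t).of_isClosed_subset ?_
    fun x hx t _ => mem_reach hx t
  have h : pathsFrom Γ K = (fun x : ℕ → State => x 0) ⁻¹' K ∩
      ⋂ t, (fun x : ℕ → State => (x t, x (t + 1))) ⁻¹' graph Γ := by
    ext x; simp [pathsFrom, graph]
  rw [h]
  refine (hK.isClosed.preimage (continuous_apply 0)).inter (isClosed_iInter fun t => ?_)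
  exact R.isClosed_graph.preimage (by fun_prop)

theorem exists_path (R : Regular Γ F β N b) (x₀ : State) : (paths Γ x₀).Nonempty := by
  choose g hg using R.nonempty
  refine ⟨fun t => g^[t] x₀, rfl, fun t => ?_⟩
  change g^[t + 1] x₀ ∈ Γ (g^[t] x₀)
  rw [Function.iterate_succ_apply']
  exact hg _

theorem return_le_bound (R : Regular Γ F β N b) {x : ℕ → State}
    (hx : ∀ t, x (t + 1) ∈ Γ (x t)) (t : ℕ) : returns F x t ≤ b (N (x 0)) t :=
  R.le_bound _ x hx le_rfl t

theorem sumExists (R : Regular Γ F β N b) {x : ℕ → State} (hx : ∀ t, x (t + 1) ∈ Γ (x t)) :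
    SumExists β (returns F x) :=
  sumExists_of_le R.β_pos.le (R.summable _) (R.return_le_bound hx)

theorem J_ne_top (R : Regular Γ F β N b) {x : ℕ → State} (hx : ∀ t, x (t + 1) ∈ Γ (x t)) :
    J F β x ≠ ⊤ :=
  ne_top_of_le_coe (total_le_tsum R.β_pos.le (R.summable _) (R.return_le_bound hx))

theorem J_eq_add (R : Regular Γ F β N b) {x : ℕ → State} (hx : ∀ t, x (t + 1) ∈ Γ (x t))
    (T : ℕ) : J F β x = partialSum β (returns F x) T +
      ((β ^ T : ℝ) : EReal) * J F β (fun t => x (T + t)) :=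
  total_eq_add R.β_pos (R.summable _) (R.return_le_bound hx) T

theorem upperSemicontinuousOn_J (R : Regular Γ F β N b) {K : Set State} (hK : IsCompact K) :
    UpperSemicontinuousOn (J F β) (pathsFrom Γ K) := by
  obtain ⟨ν, hν⟩ := hK.bddAbove_image R.size_continuous.continuousOn
  refine upperSemicontinuousOn_total R.β_pos (r := fun t x => returns F x t) (fun t => ?_)
    (R.summable ν) fun t x hx => R.le_bound ν x hx.2 (hν ⟨_, hx.1, rfl⟩) t
  exact R.continuousOn.comp (f := fun x : ℕ → State => (x t, x (t + 1))) (by fun_prop)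
    fun x hx => hx.2 t

theorem exists_optimal (R : Regular Γ F β N b) (x₀ : State) :
    ∃ x ∈ paths Γ x₀, J F β x = value Γ F β x₀ := by
  have h : pathsFrom Γ {x₀} = paths Γ x₀ := rfl
  obtain ⟨x, hx, hmax⟩ := (R.upperSemicontinuousOn_J isCompact_singleton).exists_isMaxOn
    (R.exists_path x₀) (R.isCompact_pathsFrom (K := {x₀}) isCompact_singleton)
  exact ⟨x, hx, (J_le_value hx).antisymm (iSup₂_le fun y hy => hmax hy)⟩

theorem value_ne_top (R : Regular Γ F β N b) (x₀ : State) : value Γ F β x₀ ≠ ⊤ := by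
  obtain ⟨x, hx, h⟩ := R.exists_optimal x₀
  exact h ▸ R.J_ne_top hx.2

theorem solvable (R : Regular Γ F β N b) : Solvable Γ F β :=
  ⟨fun _ _ hx => R.sumExists hx.2, R.exists_optimal, R.value_ne_top⟩

/-- The superlevel sets of the value function over a compact set of states are projections of
compact sets of paths. -/
theorem value_upperSemicontinuous (R : Regular Γ F β N b) :
    UpperSemicontinuous (value Γ F β) := by
  intro x₀ a ha
  obtain ⟨K, hK, hx₀⟩ := exists_compact_mem_nhds x₀
  have h1 := ((R.upperSemicontinuousOn_J hK).isCompact_inter_preimage_Ici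
    (R.isCompact_pathsFrom hK) a).image (continuous_apply 0)
  have h2 : x₀ ∉ (fun x : ℕ → State => x 0) '' (pathsFrom Γ K ∩ J F β ⁻¹' Set.Ici a) := by
    rintro ⟨x, ⟨hx, hxa⟩, h0⟩
    exact (not_lt.2 hxa) ((J_le_value (x₀ := x₀) ⟨h0, hx.2⟩).trans_lt ha)
  filter_upwards [hx₀, h1.isClosed.isOpen_compl.mem_nhds h2] with y hyK hy
  by_contra hlt
  obtain ⟨x, hx, hJ⟩ := R.exists_optimal y
  exact hy ⟨x, ⟨⟨hx.1 ▸ hyK, hx.2⟩, (not_lt.1 hlt).trans_eq hJ.symm⟩, hx.1⟩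

theorem return_ne_top (R : Regular Γ F β N b) {x y : State} (h : y ∈ Γ x) : F (x, y) ≠ ⊤ := by
  obtain ⟨z, hz⟩ := R.exists_path y
  have := R.return_le_bound (consPath_mem h hz).2 0
  simp only [returns, consPath, hz.1] at this
  exact ne_top_of_le_coe this

theorem J_eq_return_add (R : Regular Γ F β N b) {x : ℕ → State}
    (hx : ∀ t, x (t + 1) ∈ Γ (x t)) :
    J F β x = F (x 0, x 1) + (β : EReal) * J F β (fun t => x (t + 1)) := by
  rw [R.J_eq_add hx 1, partialSum_succ]
  simp [returns, add_comm]

theorem bellman (R : Regular Γ F β N b) : Bellman Γ F β (value Γ F β) := by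
  intro x
  apply le_antisymm
  · refine iSup₂_le fun z hz => ?_
    rw [R.J_eq_return_add hz.2, hz.1]
    refine le_trans ?_ (le_iSup₂ (z 1) (hz.1 ▸ hz.2 0))
    exact add_le_add le_rfl
      (coe_mul_mono R.β_pos.le (J_le_value ⟨rfl, fun t => hz.2 (t + 1)⟩))
  · refine iSup₂_le fun y hy => ?_
    obtain ⟨z, hz, hJ⟩ := R.exists_optimal y
    have hc := consPath_mem hy hz
    refine le_trans (le_of_eq ?_) (J_le_value hc)
    rw [R.J_eq_return_add hc.2, ← hJ]
    simp [consPath, hz.1]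

/-- Discounted values along a path are bounded by the tails of the bound on returns. -/
theorem pow_mul_value_le_tail (R : Regular Γ F β N b) {x₀ : State} {x : ℕ → State}
    (hx : x ∈ paths Γ x₀) (T : ℕ) :
    ((β ^ T : ℝ) : EReal) * value Γ F β (x T) ≤ (tail β (b (N x₀)) T : EReal) := by
  obtain ⟨y, hy, hJ⟩ := R.exists_optimal (x T)
  obtain ⟨ν, hν, hb⟩ := R.shift (N x₀) T
  have hle : N (y 0) ≤ ν := hy.1 ▸ hν x hx.2 (by rw [hx.1])
  have h := total_le_tsum R.β_pos.le (R.summable ν) (R.le_bound ν y hy.2 hle)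
  rw [← hJ]
  refine (coe_mul_mono (pow_nonneg R.β_pos.le T) h).trans_eq ?_
  rw [← EReal.coe_mul, tail, ← tsum_mul_left]
  congr 2
  ext t
  rw [hb, pow_add, add_comm t T]; ring

theorem limsup_value_le (R : Regular Γ F β N b) {x₀ : State} {x : ℕ → State}
    (hx : x ∈ paths Γ x₀) :
    limsup (fun t : ℕ => ((β ^ t : ℝ) : EReal) * value Γ F β (x t)) atTop ≤ 0 := by
  have h := EReal.tendsto_coe.2 (tendsto_tail (β := β) (b (N x₀)))
  exact (limsup_le_limsup (Eventually.of_forall (R.pow_mul_value_le_tail hx))).trans_eq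
    h.limsup_eq

/-- Along a path with finite total return, the discounted continuation returns vanish. -/
theorem tendsto_pow_mul_J (R : Regular Γ F β N b) {x₀ : State} {x : ℕ → State}
    (hx : x ∈ finitePaths Γ F β x₀) :
    Tendsto (fun T : ℕ => ((β ^ T : ℝ) : EReal) * J F β (fun t => x (T + t))) atTop (𝓝 0) := by
  have hp := R.sumExists hx.1.2
  have htop := R.J_ne_top hx.1.2
  change Tendsto _ _ (𝓝 (J F β x)) at hp
  have h := (EReal.continuousAt_add (p := (J F β x, -J F β x))
    (Or.inl htop) (Or.inl hx.2.ne')).tendsto.comp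
    (tendsto_const_nhds.prodMk_nhds (hp.neg))
  have h0 : J F β x + -J F β x = 0 := by
    rw [← sub_eq_add_neg]; exact EReal.sub_self htop hx.2.ne'
  simp only [h0] at h
  refine h.congr fun T => ?_
  have h1 : partialSum β (returns F x) T ≠ ⊥ :=
    partialSum_ne_bot R.β_pos (R.summable _) (R.return_le_bound hx.1.2) hx.2 T
  have h2 : partialSum β (returns F x) T ≠ ⊤ :=
    partialSum_ne_top R.β_pos (fun t => ne_top_of_le_coe (R.return_le_bound hx.1.2 t)) T
  simp only [Function.comp]
  rw [R.J_eq_add hx.1.2 T, ← sub_eq_add_neg]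
  lift partialSum β (returns F x) T to ℝ using ⟨h2, h1⟩ with s
  exact EReal.add_sub_cancel_left

/-- The transversality condition for the value function: its discounted values lie between the
continuation returns and the tails of the bound on returns. -/
theorem tendsto_value (R : Regular Γ F β N b) {x₀ : State} {x : ℕ → State}
    (hx : x ∈ finitePaths Γ F β x₀) :
    Tendsto (fun t : ℕ => ((β ^ t : ℝ) : EReal) * value Γ F β (x t)) atTop (𝓝 0) :=
  tendsto_of_tendsto_of_tendsto_of_le_of_le (R.tendsto_pow_mul_J hx)
    (EReal.tendsto_coe.2 (tendsto_tail (β := β) (b (N x₀))))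
    (fun T => coe_mul_mono (pow_nonneg R.β_pos.le T) (J_le_value (shift_mem hx.1 T)))
    (R.pow_mul_value_le_tail hx.1)

theorem value_mem (R : Regular Γ F β N b) : InS Γ F β (value Γ F β) :=
  ⟨R.value_ne_top, R.value_upperSemicontinuous, fun _ _ hx => R.limsup_value_le hx,
    fun _ _ hx => R.tendsto_value hx⟩

/-- An upper semicontinuous solution of the Bellman equation attains the supremum. -/
theorem exists_bellman_max (R : Regular Γ F β N b) {W : State → EReal}
    (hW : UpperSemicontinuous W) (hW' : ∀ x, W x ≠ ⊤) (hB : Bellman Γ F β W) (x : State) :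
    ∃ y ∈ Γ x, W x = F (x, y) + (β : EReal) * W y := by
  have hF : ContinuousOn (fun y => F (x, y)) (Γ x) :=
    R.continuousOn.comp (by fun_prop) fun y hy => hy
  have hmul : UpperSemicontinuousOn (fun y => (β : EReal) * W y) (Γ x) := by
    have hc : Continuous fun w : EReal => (β : EReal) * w :=
      continuous_iff_continuousAt.2 fun w => EReal.Tendsto.const_mul tendsto_id
        (Or.inl (EReal.coe_ne_bot β)) (Or.inl (EReal.coe_ne_top β))
    exact (hc.comp_upperSemicontinuous hW
      fun _ _ h => coe_mul_mono R.β_pos.le h).upperSemicontinuousOn _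
  have husc : UpperSemicontinuousOn (fun y => F (x, y) + (β : EReal) * W y) (Γ x) :=
    UpperSemicontinuousOn.add' hF.upperSemicontinuousOn hmul fun y hy =>
      EReal.continuousAt_add (Or.inl (R.return_ne_top hy))
        (Or.inr (coe_mul_ne_top R.β_pos (hW' y)))
  obtain ⟨y, hy, hmax⟩ := husc.exists_isMaxOn (R.nonempty x) (R.compact x)
  refine ⟨y, hy, (hB x).trans (le_antisymm (iSup₂_le fun z hz => hmax hz) ?_)⟩
  exact le_iSup₂ (f := fun z (_ : z ∈ Γ x) => F (x, z) + (β : EReal) * W z) y hy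

/-- Iterating the inequality `F + β W ≤ W` along a path and passing to the limit with the
transversality condition on paths with finite total return. -/
theorem J_le_of_bellman (R : Regular Γ F β N b) {W : State → EReal} (hW : InS Γ F β W)
    (hB : Bellman Γ F β W) {x₀ : State} {x : ℕ → State} (hx : x ∈ paths Γ x₀) :
    J F β x ≤ W x₀ := by
  by_cases hJ : J F β x = ⊥
  · rw [hJ]; exact bot_le
  have hfin : x ∈ finitePaths Γ F β x₀ := ⟨hx, bot_lt_iff_ne_bot.2 hJ⟩
  have hstep : ∀ T, partialSum β (returns F x) T + ((β ^ T : ℝ) : EReal) * W (x T) ≤ W x₀ := by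
    intro T
    induction T with
    | zero => simp [hx.1]
    | succ T ih =>
      refine le_trans ?_ ih
      rw [partialSum_succ, add_assoc, pow_succ, EReal.coe_mul, mul_assoc,
        ← coe_mul_add _ (pow_nonneg R.β_pos.le T)]
      refine add_le_add le_rfl (coe_mul_mono (pow_nonneg R.β_pos.le T) ?_)
      rw [hB (x T)]
      exact le_iSup₂ (f := fun z (_ : z ∈ Γ (x T)) => F (x T, z) + (β : EReal) * W z) _ (hx.2 T)
  have h := (EReal.continuousAt_add (p := (J F β x, 0)) (by simp) (by simp)).tendsto.comp
    (Tendsto.prodMk_nhds (R.sumExists hx.2) (hW.tendsto_zero x₀ x hfin))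
  simp only [add_zero] at h
  exact le_of_tendsto' h hstep

/-- A policy that attains the supremum in the equation for `W` generates a path whose total return
is at least `W`. -/
theorem le_value_of_bellman (R : Regular Γ F β N b) {W : State → EReal} (hW : InS Γ F β W)
    (hB : Bellman Γ F β W) (x₀ : State) : W x₀ ≤ value Γ F β x₀ := by
  choose g hg hgW using R.exists_bellman_max hW.usc hW.ne_top hB
  set x : ℕ → State := fun t => g^[t] x₀ with hxdef
  have hsucc : ∀ t, x (t + 1) = g (x t) := fun t => Function.iterate_succ_apply' g t x₀
  have hx : x ∈ paths Γ x₀ := ⟨rfl, fun t => hsucc t ▸ hg _⟩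
  have hstep : ∀ T, W x₀ = partialSum β (returns F x) T + ((β ^ T : ℝ) : EReal) * W (x T) := by
    intro T
    induction T with
    | zero => simp [hx.1]
    | succ T ih =>
      rw [ih, partialSum_succ, add_assoc, pow_succ, EReal.coe_mul, mul_assoc,
        ← coe_mul_add _ (pow_nonneg R.β_pos.le T), hgW (x T)]
      simp only [returns, hsucc]
  have hJ : limsup (partialSum β (returns F x)) atTop = J F β x := rfl
  have hlim := hW.limsup_le x₀ x hx
  have h := EReal.limsup_add_le (f := atTop) (u := partialSum β (returns F x))
    (v := fun t : ℕ => ((β ^ t : ℝ) : EReal) * W (x t))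
    (Or.inr (hlim.trans_lt EReal.zero_lt_top).ne) (Or.inl (hJ ▸ R.J_ne_top hx.2))
  have hconst : partialSum β (returns F x) + (fun t : ℕ => ((β ^ t : ℝ) : EReal) * W (x t)) =
      fun _ => W x₀ := funext fun T => (hstep T).symm
  rw [hconst, limsup_const, hJ] at h
  calc W x₀ ≤ J F β x + 0 := h.trans (by gcongr)
    _ = J F β x := add_zero _
    _ ≤ _ := J_le_value hx

theorem bellmanCharacterization (R : Regular Γ F β N b) : BellmanCharacterization Γ F β :=
  ⟨R.bellman, R.value_mem, fun _ hW hB => funext fun x₀ =>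
    (R.le_value_of_bellman hW hB x₀).antisymm (iSup₂_le fun _ hx => R.J_le_of_bellman hW hB hx)⟩

theorem value_continuous (R : Regular Γ F β N b) (hV : LowerSemicontinuous (value Γ F β)) :
    Continuous (value Γ F β) :=
  continuous_iff_lower_upperSemicontinuous.2 ⟨hV, R.value_upperSemicontinuous⟩

end Regular

theorem valueContinuity_of_continuous {Γ : State → Set State} {F : State × State → EReal} {β : ℝ}
    (h : Continuous (value Γ F β)) : ValueContinuity Γ F β :=
  ⟨fun _ _ _ _ => h.continuousAt, fun x₀ h0 _ hy => h0 ▸ (h.tendsto x₀).comp hy⟩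

end DynProg

namespace LucasUzawa

open DynProg

variable (M : LucasUzawa)

/-! ### Utility -/

/-- The real-valued utility of positive consumption. -/
noncomputable def realU (c : ℝ) : ℝ := if M.θ = 0 then Real.log c else (c ^ M.θ - 1) / M.θ

theorem U_of_pos {c : ℝ≥0} (hc : 0 < c) : M.U c = (M.realU c : EReal) := by
  unfold U realU
  rw [if_neg (by simp [hc.ne'])]
  split_ifs <;> rfl

theorem U_zero_of_nonpos (hθ : M.θ ≤ 0) : M.U 0 = ⊥ := by simp [U, hθ]

theorem U_zero_of_pos (hθ : 0 < M.θ) : M.U 0 = ((-1 / M.θ : ℝ) : EReal) := by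
  simp [U, hθ.not_ge, hθ.ne', Real.zero_rpow hθ.ne']

theorem realU_mono {c d : ℝ} (hc : 0 < c) (h : c ≤ d) : M.realU c ≤ M.realU d := by
  unfold realU
  rcases lt_trichotomy M.θ 0 with hθ | hθ | hθ
  · rw [if_neg hθ.ne, if_neg hθ.ne]
    refine (div_le_div_right_of_neg hθ).2 ?_
    have := Real.rpow_le_rpow_of_nonpos hc h hθ.le
    linarith
  · simp only [hθ, if_true]
    exact Real.log_le_log hc h
  · rw [if_neg hθ.ne', if_neg hθ.ne']
    have := Real.rpow_le_rpow hc.le h hθ.le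
    gcongr

theorem U_mono : Monotone M.U := by
  intro c d h
  rcases eq_or_ne c 0 with rfl | hc
  · rcases le_or_gt M.θ 0 with hθ | hθ
    · rw [M.U_zero_of_nonpos hθ]; exact bot_le
    · rcases eq_or_ne d 0 with rfl | hd
      · exact le_rfl
      · rw [M.U_zero_of_pos hθ, M.U_of_pos (pos_iff_ne_zero.2 hd), realU, if_neg hθ.ne']
        refine EReal.coe_le_coe_iff.2 ?_
        have : (0 : ℝ) ≤ (d : ℝ) ^ M.θ := by positivity
        gcongr
        linarith
  · have hc' := pos_iff_ne_zero.2 hc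
    rw [M.U_of_pos hc', M.U_of_pos (hc'.trans_le h)]
    exact EReal.coe_le_coe_iff.2 (M.realU_mono (by exact_mod_cast hc') (by exact_mod_cast h))

/-- Scaling consumption acts on utility by a positive affine map. -/
theorem U_mul {m : ℝ≥0} (hm : 0 < m) (c : ℝ≥0) :
    M.U (m * c) = (((m : ℝ) ^ M.θ : ℝ) : EReal) * M.U c + (M.realU m : EReal) := by
  have hm' : (0 : ℝ) < m := hm
  have hpow : (0 : ℝ) < (m : ℝ) ^ M.θ := Real.rpow_pos_of_pos hm' _
  rcases eq_or_ne c 0 with rfl | hc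
  · rw [mul_zero]
    rcases le_or_gt M.θ 0 with hθ | hθ
    · rw [M.U_zero_of_nonpos hθ, EReal.coe_mul_bot_of_pos hpow, EReal.bot_add]
    · rw [M.U_zero_of_pos hθ, realU, if_neg hθ.ne', ← EReal.coe_mul, ← EReal.coe_add]
      congr 1
      field_simp
      ring
  · have hc' := pos_iff_ne_zero.2 hc
    have hc'' : (0 : ℝ) < c := hc'
    rw [M.U_of_pos hc', M.U_of_pos (mul_pos hm hc'), ← EReal.coe_mul, ← EReal.coe_add]
    congr 1
    unfold realU
    push_cast
    split_ifs with hθ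
    · rw [hθ, Real.rpow_zero, Real.log_mul hm'.ne' hc''.ne']; ring
    · rw [Real.mul_rpow hm'.le hc''.le]
      field_simp
      ring

theorem realU_one : M.realU 1 = 0 := by simp [realU]

theorem continuousAt_realU : ContinuousAt M.realU 1 := by
  unfold realU
  split_ifs
  · exact Real.continuousAt_log one_ne_zero
  · exact ((Real.continuousAt_rpow_const 1 M.θ (Or.inl one_ne_zero)).sub
      continuousAt_const).div_const _

/-! ### Time left for market activities -/

theorem φ_one_pos : 0 < M.φ 1 := (div_pos M.δh_pos M.B_pos).trans M.φ_one

theorem Dh_pos : 0 < M.Dh := by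
  have := mul_pos M.B_pos M.φ_one_pos
  have := M.δh_lt_one
  unfold Dh; linarith

theorem φinv_spec {y : ℝ} (hy : y ∈ Set.Icc 0 (M.φ 1)) :
    M.φinv y ∈ Set.Icc (0 : ℝ) 1 ∧ M.φ (M.φinv y) = y := by
  have h : y ∈ M.φ '' Set.Icc 0 1 :=
    intermediate_value_Icc zero_le_one M.φ_continuous (by rwa [M.φ_zero])
  exact ⟨Function.invFunOn_mem h, Function.invFunOn_eq h⟩

theorem φinv_le_φinv {y z : ℝ} (hy : y ∈ Set.Icc 0 (M.φ 1)) (hz : z ∈ Set.Icc 0 (M.φ 1))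
    (h : y ≤ z) : M.φinv y ≤ M.φinv z := by
  have h1 := M.φinv_spec hy
  have h2 := M.φinv_spec hz
  rwa [← M.φ_strictMono.le_iff_le h1.1 h2.1, h1.2, h2.2]

theorem φ_mem {v : ℝ} (hv : v ∈ Set.Icc (0 : ℝ) 1) : M.φ v ∈ Set.Icc 0 (M.φ 1) := by
  have hmono := M.φ_strictMono.monotoneOn
  exact ⟨M.φ_zero ▸ hmono (by simp) hv hv.1, hmono hv (by simp) hv.2⟩

theorem φinv_φ {v : ℝ} (hv : v ∈ Set.Icc (0 : ℝ) 1) : M.φinv (M.φ v) = v := by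
  have h := M.φinv_spec (M.φ_mem hv)
  exact M.φ_strictMono.injOn h.1 hv h.2

/-- The value of `φ` that is needed for growth from `h` to `h'`. -/
theorem ψ_arg_mem {h h' : ℝ≥0} (hh : h ≠ 0) (h1 : (1 - M.δh) * h < h') (h2 : h' ≤ M.Dh * h) :
    1 / M.B * ((h' : ℝ) / h - (1 - M.δh)) ∈ Set.Icc 0 (M.φ 1) := by
  have hpos : (0 : ℝ) < h := by exact_mod_cast pos_iff_ne_zero.2 hh
  have hB := M.B_pos
  have h1' := (lt_div_iff₀ hpos).2 h1
  have h2' := (div_le_iff₀ hpos).2 h2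
  constructor
  · exact mul_nonneg (by positivity) (by linarith)
  · rw [one_div_mul_eq_div, div_le_iff₀ hB]
    unfold Dh at h2'
    linarith

theorem ψ_mem {h h' : ℝ≥0} (h2 : h' ≤ M.Dh * h) : M.ψ h h' ∈ Set.Icc (0 : ℝ) 1 := by
  unfold ψ
  split_ifs with hc
  · simp
  · push Not at hc
    have := (M.φinv_spec (M.ψ_arg_mem hc.1 hc.2 h2)).1
    exact ⟨by linarith [this.2], by linarith [this.1]⟩

/-- A larger current stock of human capital leaves more time for market activities. -/
theorem ψ_mono {h g h' : ℝ≥0} (hg : h ≤ g) (h2 : h' ≤ M.Dh * h) : M.ψ h h' ≤ M.ψ g h' := by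
  by_cases hc : g = 0 ∨ (h' : ℝ) ≤ (1 - M.δh) * g
  · have : M.ψ g h' = 1 := if_pos hc
    exact this ▸ (M.ψ_mem h2).2
  have hc' := hc
  push Not at hc'
  have hδ : 0 < 1 - M.δh := sub_pos.2 M.δh_lt_one
  have hgR : (h : ℝ) ≤ g := by exact_mod_cast hg
  have hlt : (1 - M.δh) * h < h' := (mul_le_mul_of_nonneg_left hgR hδ.le).trans_lt hc'.2
  have hh : h ≠ 0 := by
    rintro rfl
    simp only [NNReal.coe_zero, mul_zero] at h2 hlt
    linarith
  have hpos : (0 : ℝ) < h := by exact_mod_cast pos_iff_ne_zero.2 hh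
  have hg2 : (h' : ℝ) ≤ M.Dh * g := h2.trans (mul_le_mul_of_nonneg_left hgR M.Dh_pos.le)
  have hcc : ¬(h = 0 ∨ (h' : ℝ) ≤ (1 - M.δh) * h) := by
    push Not; exact ⟨hh, hlt⟩
  unfold ψ
  rw [if_neg hc, if_neg hcc]
  have hB := M.B_pos
  have := M.φinv_le_φinv (M.ψ_arg_mem hc'.1 hc'.2 hg2) (M.ψ_arg_mem hh hlt h2) (by gcongr)
  linarith

theorem ψ_mul {m : ℝ≥0} (hm : 0 < m) (h h' : ℝ≥0) : M.ψ (m * h) (m * h') = M.ψ h h' := by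
  have hm' : (0 : ℝ) < m := hm
  have h1 : (((m * h' : ℝ≥0) : ℝ) ≤ (1 - M.δh) * (m * h : ℝ≥0)) ↔
      ((h' : ℝ) ≤ (1 - M.δh) * h) := by
    push_cast
    rw [mul_left_comm, mul_le_mul_iff_right₀ hm']
  unfold ψ
  simp only [h1, mul_eq_zero, hm.ne', false_or]
  push_cast
  rw [mul_div_mul_left _ _ hm'.ne']

theorem one_sub_le_ψ {v h h' : ℝ≥0} (hv : v ≤ 1)
    (hh : (h' : ℝ) = (M.B * M.φ v + (1 - M.δh)) * h) : 1 - (v : ℝ) ≤ M.ψ h h' := by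
  unfold ψ
  split_ifs with hc
  · simp
  · push Not at hc
    have hpos : (h : ℝ) ≠ 0 := by exact_mod_cast hc.1
    have hB := M.B_pos.ne'
    have hv' : (v : ℝ) ∈ Set.Icc (0 : ℝ) 1 := ⟨v.2, by exact_mod_cast hv⟩
    have : 1 / M.B * ((h' : ℝ) / h - (1 - M.δh)) = M.φ v := by
      rw [hh]; field_simp; ring
    rw [this, M.φinv_φ hv']

/-! ### Monotonicity and homogeneity of the reduced form -/

theorem one_add_n_pos : 0 < 1 + M.n := by linarith [M.n_nonneg]

theorem Γhat_mono {x y x' : State} (hxy : x ≤ y) (h : x' ∈ M.Γhat x) : x' ∈ M.Γhat y := by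
  have h1 : (x.1 : ℝ) ≤ y.1 := by exact_mod_cast hxy.1
  have h2 : (x.2 : ℝ) ≤ y.2 := by exact_mod_cast hxy.2
  have hA := M.A_pos
  have hα := M.α_pos.le
  have hγ : 0 ≤ 1 - M.α + M.γ := by linarith [M.α_lt_one, M.γ_nonneg]
  have hδ : 0 ≤ 1 - M.δk := by linarith [M.δk_lt_one]
  have hn := M.one_add_n_pos
  have hD := M.Dh_pos
  refine ⟨h.1.trans ?_, h.2.trans ?_⟩ <;> gcongr

theorem fhat_mono {x y x' : State} (hxy : x ≤ y) (h : x' ∈ M.Γhat x) :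
    M.fhat (x, x') ≤ M.fhat (y, x') := by
  have h1 : (x.1 : ℝ) ≤ y.1 := by exact_mod_cast hxy.1
  have h2 : (x.2 : ℝ) ≤ y.2 := by exact_mod_cast hxy.2
  have h3 := M.ψ_mono hxy.2 h.2
  have h4 := (M.ψ_mem h.2).1
  have h5 := h4.trans h3
  have hA := M.A_pos
  have hα := M.α_pos.le
  have hα1 : 0 ≤ 1 - M.α := by linarith [M.α_lt_one]
  have hγ : 0 ≤ 1 - M.α + M.γ := by linarith [M.γ_nonneg]
  have hδ : 0 ≤ 1 - M.δk := by linarith [M.δk_lt_one]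
  unfold fhat
  dsimp only
  gcongr

theorem Fhat_mono {x y x' : State} (hxy : x ≤ y) (h : x' ∈ M.Γhat x) :
    M.Fhat (x, x') ≤ M.Fhat (y, x') :=
  M.U_mono (Real.toNNReal_le_toNNReal (M.fhat_mono hxy h))

/-- The exponent `ρ` for which output is homogeneous of degree one in `(k, h ^ ρ)`. -/
noncomputable def ρ : ℝ := (1 - M.α + M.γ) / (1 - M.α)

theorem ρ_pos : 0 < M.ρ :=
  div_pos (by linarith [M.α_lt_one, M.γ_nonneg]) (by linarith [M.α_lt_one])

/-- Scaling human capital by `μ` and physical capital by `μ ^ ρ`. -/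
noncomputable def scale (μ : ℝ≥0) (x : State) : State := (μ ^ M.ρ * x.1, μ * x.2)

theorem scale_output {μ : ℝ≥0} (hμ : 0 < μ) (k h : ℝ≥0) :
    (((μ ^ M.ρ * k : ℝ≥0) : ℝ) ^ M.α) * (((μ * h : ℝ≥0) : ℝ) ^ (1 - M.α + M.γ)) =
      (μ : ℝ) ^ M.ρ * ((k : ℝ) ^ M.α * (h : ℝ) ^ (1 - M.α + M.γ)) := by
  have hμ' : (0 : ℝ) < μ := hμ
  have hα1 : 1 - M.α ≠ 0 := by linarith [M.α_lt_one]
  have he : 1 - M.α + M.γ = M.ρ * (1 - M.α) := by unfold ρ; field_simp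
  have hsplit : (μ : ℝ) ^ (M.ρ * M.α) * (μ : ℝ) ^ (M.ρ * (1 - M.α)) = (μ : ℝ) ^ M.ρ := by
    rw [← Real.rpow_add hμ']; congr 1; ring
  push_cast
  rw [Real.mul_rpow (by positivity) (by positivity), Real.mul_rpow (by positivity) (by positivity),
    ← Real.rpow_mul hμ'.le, he, ← hsplit]
  ring

theorem scale_mem {μ : ℝ≥0} (hμ : 0 < μ) {x y : State} (h : y ∈ M.Γhat x) :
    M.scale μ y ∈ M.Γhat (M.scale μ x) := by
  have hρ : (0 : ℝ) < (μ : ℝ) ^ M.ρ := Real.rpow_pos_of_pos hμ _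
  constructor
  · have h1 := mul_le_mul_of_nonneg_left h.1 hρ.le
    simp only [scale]
    rw [mul_assoc M.A, M.scale_output hμ]
    push_cast
    refine h1.trans_eq ?_
    ring
  · have h2 := mul_le_mul_of_nonneg_left h.2 μ.2
    simp only [scale]
    push_cast
    exact h2.trans_eq (mul_left_comm _ _ _)

theorem fhat_scale {μ : ℝ≥0} (hμ : 0 < μ) (x y : State) :
    M.fhat (M.scale μ x, M.scale μ y) = (μ : ℝ) ^ M.ρ * M.fhat (x, y) := by
  have h := M.scale_output hμ x.1 x.2
  simp only [fhat, scale]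
  rw [M.ψ_mul hμ, mul_right_comm _ (M.ψ x.2 y.2 ^ (1 - M.α)), mul_assoc M.A, h]
  push_cast
  ring

theorem Fhat_scale {μ : ℝ≥0} (hμ : 0 < μ) (x y : State) :
    M.Fhat (M.scale μ x, M.scale μ y) =
      ((((μ : ℝ) ^ M.ρ) ^ M.θ : ℝ) : EReal) * M.Fhat (x, y) +
        (M.realU ((μ : ℝ) ^ M.ρ) : EReal) := by
  have hρ : (0 : ℝ) ≤ (μ : ℝ) ^ M.ρ := Real.rpow_nonneg μ.2 _
  have hpos : 0 < μ ^ M.ρ := NNReal.rpow_pos hμ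
  have hcast : ((μ : ℝ) ^ M.ρ).toNNReal = μ ^ M.ρ := by
    rw [← NNReal.coe_rpow, Real.toNNReal_coe]
  have h := M.U_mul hpos (M.fhat (x, y)).toNNReal
  rw [NNReal.coe_rpow] at h
  rw [Fhat, M.fhat_scale hμ, Real.toNNReal_mul hρ, hcast, h, Fhat]

/-! ### Lower semicontinuity of the value function -/

theorem fst_eq_zero_of_mem {x y : State} (h : y ∈ M.Γhat x) (hx : x.1 = 0) : y.1 = 0 := by
  have h1 := h.1
  simp only [hx, NNReal.coe_zero, Real.zero_rpow M.α_pos.ne', mul_zero, zero_mul, add_zero,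
    zero_div] at h1
  exact le_antisymm (by exact_mod_cast h1) zero_le

theorem Fhat_of_fst_eq_zero {x y : State} (hx : x.1 = 0) : M.Fhat (x, y) = M.U 0 := by
  have hn := M.one_add_n_pos
  have : (0 : ℝ) ≤ (1 + M.n) * y.1 := by positivity
  rw [M.Fhat_of_zero _ (Or.inl hx), Real.toNNReal_of_nonpos]
  simp only [hx, NNReal.coe_zero]
  linarith

/-- Without physical capital there is no consumption, so that the value is minimal. -/
theorem value_le_of_fst_eq_zero {N : State → ℝ} {b : ℝ → ℕ → ℝ}
    (R : Regular M.Γhat M.Fhat M.β N b) {x₀ : State} (hx₀ : x₀.1 = 0) (y : State) :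
    value M.Γhat M.Fhat M.β x₀ ≤ value M.Γhat M.Fhat M.β y := by
  obtain ⟨z, hz⟩ := R.exists_path y
  refine iSup₂_le fun x hx => le_trans ?_ (J_le_value hz)
  have h0 : ∀ t, (x t).1 = 0 := fun t => by
    induction t with
    | zero => rw [hx.1, hx₀]
    | succ t ih => exact M.fst_eq_zero_of_mem (hx.2 t) ih
  refine total_mono M.β_pos.le fun t => ?_
  rw [returns, M.Fhat_of_fst_eq_zero (h0 t)]
  exact M.U_mono zero_le

/-- A path from `x₀` whose states are scaled from the first period on is feasible from each initial
state `y` that dominates the scaled `x₀`, and it yields at least the scaled returns. -/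
theorem J_scale_le_value {N : State → ℝ} {b : ℝ → ℕ → ℝ}
    (R : Regular M.Γhat M.Fhat M.β N b) {x₀ y : State} {x : ℕ → State}
    (hx : x ∈ paths M.Γhat x₀) {μ : ℝ≥0} (hμ : 0 < μ) (hy : M.scale μ x₀ ≤ y) :
    ((((μ : ℝ) ^ M.ρ) ^ M.θ : ℝ) : EReal) * J M.Fhat M.β x +
      ((M.realU ((μ : ℝ) ^ M.ρ) * (1 - M.β)⁻¹ : ℝ) : EReal) ≤ value M.Γhat M.Fhat M.β y := by
  have hmem : M.scale μ (x 1) ∈ M.Γhat (M.scale μ x₀) := hx.1 ▸ M.scale_mem hμ (hx.2 0)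
  have hz : consPath y (fun t => M.scale μ (x (t + 1))) ∈ paths M.Γhat y :=
    consPath_mem (M.Γhat_mono hy hmem) ⟨rfl, fun t => M.scale_mem hμ (hx.2 (t + 1))⟩
  have hpos : (0 : ℝ) ≤ ((μ : ℝ) ^ M.ρ) ^ M.θ := by positivity
  refine le_trans ?_ (J_le_value hz)
  unfold J
  rw [← total_affine M.β_pos.le M.β_lt_one (R.sumExists hx.2) hpos]
  refine total_mono M.β_pos.le fun t => ?_
  rw [returns, ← M.Fhat_scale hμ]
  rcases t with _ | t
  · have := M.Fhat_mono hy hmem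
    rwa [← hx.1] at this
  · exact le_rfl

theorem value_lowerSemicontinuous {N : State → ℝ} {b : ℝ → ℕ → ℝ}
    (R : Regular M.Γhat M.Fhat M.β N b) :
    LowerSemicontinuous (value M.Γhat M.Fhat M.β) := by
  intro x₀ a ha
  by_cases hk : x₀.1 = 0
  · exact Eventually.of_forall fun y => ha.trans_le (M.value_le_of_fst_eq_zero R hk y)
  obtain ⟨x, hx, hJ⟩ := R.exists_optimal x₀
  rw [← hJ] at ha
  obtain ⟨j, hj⟩ : ∃ j : ℝ, J M.Fhat M.β x = j :=
    ⟨_, (EReal.coe_toReal (R.J_ne_top hx.2) (bot_le.trans_lt ha).ne').symm⟩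
  -- The lower bound obtained from scaling tends to `j` as the scale tends to one from below.
  have hρ : ContinuousAt (fun μ : ℝ≥0 => (μ : ℝ) ^ M.ρ) 1 :=
    (Real.continuousAt_rpow_const _ _ (Or.inl (by simp))).comp
      NNReal.continuous_coe.continuousAt
  have hρ1 : ((1 : ℝ≥0) : ℝ) ^ M.ρ = 1 := by simp
  have hU : ContinuousAt (fun μ : ℝ≥0 => M.realU ((μ : ℝ) ^ M.ρ)) 1 :=
    ContinuousAt.comp (g := M.realU) (by rw [hρ1]; exact M.continuousAt_realU) hρ
  have hθ : ContinuousAt (fun μ : ℝ≥0 => ((μ : ℝ) ^ M.ρ) ^ M.θ) 1 :=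
    hρ.rpow_const (Or.inl (by rw [hρ1]; exact one_ne_zero))
  have hlim := continuous_coe_real_ereal.continuousAt.comp
    ((hθ.mul_const j).add (hU.mul_const (1 - M.β)⁻¹))
  have hev := hlim.tendsto.eventually_const_lt (u := a) (by
    simpa [Function.comp, hρ1, M.realU_one, ← hj] using ha)
  have : (𝓝[<] (1 : ℝ≥0)).NeBot := nhdsLT_neBot_of_exists_lt ⟨0, zero_lt_one⟩
  obtain ⟨μ, ⟨hμa, hμ0⟩, hμ1⟩ := ((hev.and (lt_mem_nhds zero_lt_one)).filter_mono
    nhdsWithin_le_nhds |>.and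
    (self_mem_nhdsWithin : Set.Iio (1 : ℝ≥0) ∈ 𝓝[<] 1)).exists
  have hμ1' : μ < 1 := hμ1
  have hk1 : μ ^ M.ρ * x₀.1 < x₀.1 :=
    mul_lt_of_lt_one_left (pos_iff_ne_zero.2 hk) (NNReal.rpow_lt_one hμ1' M.ρ_pos)
  have hky : ∀ᶠ y : State in 𝓝 x₀, μ ^ M.ρ * x₀.1 < y.1 :=
    continuous_fst.continuousAt.eventually_const_lt hk1
  have hhy : ∀ᶠ y : State in 𝓝 x₀, μ * x₀.2 ≤ y.2 := by
    rcases eq_or_ne x₀.2 0 with h0 | h0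
    · simp [h0]
    · have hlt : μ * x₀.2 < x₀.2 := mul_lt_of_lt_one_left (pos_iff_ne_zero.2 h0) hμ1'
      exact (continuous_snd.continuousAt.eventually_const_lt hlt).mono fun y => le_of_lt
  filter_upwards [hky, hhy] with y hy1 hy2
  refine lt_of_lt_of_le hμa ?_
  have h := M.J_scale_le_value R hx hμ0 (y := y) ⟨hy1.le, hy2⟩
  rw [hj] at h
  exact_mod_cast h

/-! ### Existence of optimal plans -/

/-- Utility is a return: without human capital, and if nothing is left for the future, the
undepreciated capital is consumed. -/
theorem U_eq_Fhat (c : ℝ≥0) :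
    M.U c = M.Fhat ((c / (1 - M.δk).toNNReal, 0), 0) := by
  have hδ : 0 < 1 - M.δk := sub_pos.2 M.δk_lt_one
  have h1 : ((1 - M.δk).toNNReal : ℝ) = 1 - M.δk := Real.coe_toNNReal _ hδ.le
  rw [M.Fhat_of_zero _ (Or.inr rfl)]
  simp [h1, mul_div_cancel₀ _ hδ.ne']

/-- Continuity of utility is inherited from the return function of the reduced form. -/
theorem continuous_U (h : ContinuousOn M.Fhat (graph M.Γhat)) : Continuous M.U := by
  rw [funext M.U_eq_Fhat]
  refine h.comp_continuous (by fun_prop) fun c => ?_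
  have hδ : 0 ≤ 1 - M.δk := by linarith [M.δk_lt_one]
  have hn := M.one_add_n_pos
  have hγ : 1 - M.α + M.γ ≠ 0 := by linarith [M.α_lt_one, M.γ_nonneg]
  constructor
  · simp only [Prod.fst_zero, NNReal.coe_zero, Real.zero_rpow hγ, mul_zero, zero_add]
    positivity
  · simp

/-- The state sequence of a plan. -/
def Plan.states (P : Plan) (t : ℕ) : State := (P.k t, P.h t)

variable {M}

theorem Feasible.u_le {x₀ : State} {P : Plan} (hP : M.Feasible x₀ P) (t : ℕ) :
    (P.u t : ℝ) ≤ 1 - P.v t := by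
  have : ((P.u t + P.v t : ℝ≥0) : ℝ) ≤ 1 := by exact_mod_cast hP.time t
  push_cast at this
  linarith

theorem Feasible.v_le {x₀ : State} {P : Plan} (hP : M.Feasible x₀ P) (t : ℕ) : P.v t ≤ 1 :=
  le_trans le_add_self (hP.time t)

theorem Feasible.states_mem {x₀ : State} {P : Plan} (hP : M.Feasible x₀ P) :
    P.states ∈ paths M.Γhat x₀ := by
  refine ⟨Prod.ext hP.init_k hP.init_h, fun t => ⟨?_, ?_⟩⟩
  · have hr := hP.resource t
    have hv : (0 : ℝ) ≤ P.v t := (P.v t).2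
    have hu : (P.u t : ℝ) ^ (1 - M.α) ≤ 1 :=
      Real.rpow_le_one (P.u t).2 (by linarith [hP.u_le t]) (by linarith [M.α_lt_one])
    have hA := M.A_pos
    have hle : M.A * (P.k t : ℝ) ^ M.α * (P.u t : ℝ) ^ (1 - M.α) * (P.h t : ℝ) ^ (1 - M.α + M.γ) ≤
        M.A * (P.k t : ℝ) ^ M.α * 1 * (P.h t : ℝ) ^ (1 - M.α + M.γ) := by gcongr
    have hc : (0 : ℝ) ≤ P.c t := (P.c t).2
    rw [le_div_iff₀ M.one_add_n_pos]
    simp only [Plan.states]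
    linarith
  · have hφ := (M.φ_mem ⟨(P.v t).2, by exact_mod_cast hP.v_le t⟩).2
    have hB := M.B_pos
    simp only [Plan.states, hP.human t, Dh]
    gcongr
    exact hφ

/-- Consumption in a plan is at most consumption in the reduced form, which wastes neither time nor
output. -/
theorem Feasible.utility_le {x₀ : State} {P : Plan} (hP : M.Feasible x₀ P) (t : ℕ) :
    M.utilities P t ≤ returns M.Fhat P.states t := by
  refine M.U_mono (NNReal.le_toNNReal_of_coe_le ?_)
  have hu := (hP.u_le t).trans (M.one_sub_le_ψ (hP.v_le t) (hP.human t))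
  have hα1 : 0 ≤ 1 - M.α := by linarith [M.α_lt_one]
  have hA := M.A_pos
  have hr := hP.resource t
  have hle : M.A * (P.k t : ℝ) ^ M.α * (P.u t : ℝ) ^ (1 - M.α) * (P.h t : ℝ) ^ (1 - M.α + M.γ) ≤
      M.A * (P.k t : ℝ) ^ M.α * M.ψ (P.h t) (P.h (t + 1)) ^ (1 - M.α) *
        (P.h t : ℝ) ^ (1 - M.α + M.γ) := by gcongr
  simp only [fhat, Plan.states]
  linarith

theorem Feasible.utility_le_bound {N : State → ℝ} {b : ℝ → ℕ → ℝ}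
    (R : Regular M.Γhat M.Fhat M.β N b) {x₀ : State} {P : Plan} (hP : M.Feasible x₀ P) (t : ℕ) :
    M.utilities P t ≤ b (N x₀) t := by
  have h := R.return_le_bound hP.states_mem.2 t
  rw [hP.states_mem.1] at h
  exact (hP.utility_le t).trans h

variable (M)

/-- Consumption when physical and human capital move from `x` to `y`, the share `v` of time is
spent on human capital accumulation, and neither time nor output is wasted. -/
noncomputable def netOutput (v : ℝ≥0) (x y : State) : ℝ :=
  M.A * (x.1 : ℝ) ^ M.α * (1 - v : ℝ≥0) ^ (1 - M.α) * (x.2 : ℝ) ^ (1 - M.α + M.γ)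
    + (1 - M.δk) * x.1 - (1 + M.n) * y.1

/-- Sequences of human capital investments and states that determine a feasible plan without
waste. -/
def programs (x₀ : State) : Set (ℕ → ℝ≥0 × State) :=
  {q | (q 0).2 = x₀ ∧ ∀ t, (q t).1 ≤ 1 ∧
    ((q (t + 1)).2.2 : ℝ) = (M.B * M.φ (q t).1 + (1 - M.δh)) * (q t).2.2 ∧
    0 ≤ M.netOutput (q t).1 (q t).2 (q (t + 1)).2}

/-- The plan without waste determined by a program. -/
noncomputable def planOf (q : ℕ → ℝ≥0 × State) : Plan where
  c t := (M.netOutput (q t).1 (q t).2 (q (t + 1)).2).toNNReal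
  u t := 1 - (q t).1
  v t := (q t).1
  k t := (q t).2.1
  h t := (q t).2.2

theorem planOf_feasible {x₀ : State} {q : ℕ → ℝ≥0 × State} (hq : q ∈ M.programs x₀) :
    M.Feasible x₀ (M.planOf q) where
  init_k := congrArg Prod.fst hq.1
  init_h := congrArg Prod.snd hq.1
  resource t := by
    simp only [planOf]
    rw [Real.coe_toNNReal _ (hq.2 t).2.2, netOutput]
    linarith
  human t := (hq.2 t).2.1
  time t := (tsub_add_cancel_of_le (hq.2 t).1).le

/-- Every feasible plan is dominated by the plan without waste that has the same human capital
investments and the same states. -/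
theorem exists_program {x₀ : State} {P : Plan} (hP : M.Feasible x₀ P) :
    ∃ q ∈ M.programs x₀, ∀ t, M.utilities P t ≤ M.utilities (M.planOf q) t := by
  have hle : ∀ t, (P.c t : ℝ) ≤ M.netOutput (P.v t) (P.states t) (P.states (t + 1)) := by
    intro t
    have hu : P.u t ≤ 1 - P.v t := le_tsub_of_add_le_right (hP.time t)
    have hα1 : 0 ≤ 1 - M.α := by linarith [M.α_lt_one]
    have hA := M.A_pos
    have hr := hP.resource t
    have hle : M.A * (P.k t : ℝ) ^ M.α * (P.u t : ℝ) ^ (1 - M.α) *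
        (P.h t : ℝ) ^ (1 - M.α + M.γ) ≤
        M.A * (P.k t : ℝ) ^ M.α * (1 - P.v t : ℝ≥0) ^ (1 - M.α) *
        (P.h t : ℝ) ^ (1 - M.α + M.γ) := by
      have hu' : (P.u t : ℝ) ≤ (1 - P.v t : ℝ≥0) := by exact_mod_cast hu
      gcongr
    simp only [netOutput, Plan.states]
    linarith
  exact ⟨fun t => (P.v t, P.states t), ⟨hP.states_mem.1, fun t => ⟨hP.v_le t, hP.human t,
    (P.c t).2.trans (hle t)⟩⟩, fun t => M.U_mono (NNReal.le_toNNReal_of_coe_le (hle t))⟩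

theorem programs_nonempty (x₀ : State) : (M.programs x₀).Nonempty := by
  have hδh : 0 ≤ 1 - M.δh := by linarith [M.δh_lt_one]
  have hδk : 0 ≤ 1 - M.δk := by linarith [M.δk_lt_one]
  have hA := M.A_pos
  refine ⟨fun t => (0, if t = 0 then x₀.1 else 0, (1 - M.δh).toNNReal ^ t * x₀.2), ?_, ?_⟩
  · simp
  · refine fun t => ⟨zero_le, ?_, ?_⟩
    · simp [M.φ_zero, pow_succ, Real.coe_toNNReal _ hδh]
      ring
    · simp only [netOutput, if_neg (Nat.succ_ne_zero t), NNReal.coe_zero, mul_zero, sub_zero]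
      positivity

theorem continuous_netOutput :
    Continuous fun p : ℝ≥0 × State × State => M.netOutput p.1 p.2.1 p.2.2 := by
  have h1 := Real.continuous_rpow_const M.α_pos.le
  have h2 := Real.continuous_rpow_const (q := 1 - M.α) (by linarith [M.α_lt_one])
  have h3 := Real.continuous_rpow_const (q := 1 - M.α + M.γ)
    (by linarith [M.α_lt_one, M.γ_nonneg])
  have h1' : Continuous fun p : ℝ≥0 × State × State => (p.2.1.1 : ℝ) ^ M.α :=
    h1.comp (by fun_prop)
  have h2' : Continuous fun p : ℝ≥0 × State × State => ((1 - p.1 : ℝ≥0) : ℝ) ^ (1 - M.α) :=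
    h2.comp (by fun_prop)
  have h3' : Continuous fun p : ℝ≥0 × State × State => (p.2.1.2 : ℝ) ^ (1 - M.α + M.γ) :=
    h3.comp (by fun_prop)
  unfold netOutput
  fun_prop

theorem isClosed_programs (x₀ : State) : IsClosed (M.programs x₀) := by
  -- Truncation at one makes `φ` continuous on the whole half-line.
  have hφ : Continuous fun v : ℝ≥0 => M.φ (min v 1 : ℝ≥0) :=
    M.φ_continuous.comp_continuous (by fun_prop) fun v => ⟨NNReal.coe_nonneg _, by simp⟩
  have heq : M.programs x₀ = {q | (q 0).2 = x₀} ∩ ⋂ t, {q | (q t).1 ≤ 1} ∩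
      {q | ((q (t + 1)).2.2 : ℝ) = (M.B * M.φ (min (q t).1 1 : ℝ≥0) + (1 - M.δh)) * (q t).2.2} ∩
      {q | 0 ≤ M.netOutput (q t).1 (q t).2 (q (t + 1)).2} := by
    ext q
    simp only [programs, Set.mem_ofPred_eq, Set.mem_inter_iff, Set.mem_iInter, and_assoc]
    refine and_congr_right fun _ => forall_congr' fun t => and_congr_right fun h => ?_
    rw [min_eq_left h]
  rw [heq]
  refine (isClosed_eq (by fun_prop) continuous_const).inter (isClosed_iInter fun t => ?_)
  refine ((isClosed_le (by fun_prop) continuous_const).inter (isClosed_eq (by fun_prop) ?_)).inter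
    (isClosed_le continuous_const ?_)
  · have : Continuous fun q : ℕ → ℝ≥0 × State => M.φ (min (q t).1 1 : ℝ≥0) :=
      hφ.comp (by fun_prop)
    fun_prop
  · exact M.continuous_netOutput.comp
      (f := fun q : ℕ → ℝ≥0 × State => ((q t).1, (q t).2, (q (t + 1)).2)) (by fun_prop)

theorem isCompact_programs {N : State → ℝ} {b : ℝ → ℕ → ℝ}
    (R : Regular M.Γhat M.Fhat M.β N b) (x₀ : State) : IsCompact (M.programs x₀) := by
  refine (isCompact_univ_pi fun t => (isCompact_Icc (a := (0 : ℝ≥0)) (b := 1)).prod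
    (R.isCompact_reach (isCompact_singleton (x := x₀)) t)).of_isClosed_subset
    (M.isClosed_programs x₀) fun q hq t _ => ⟨⟨zero_le, (hq.2 t).1⟩, ?_⟩
  exact mem_reach (Γ := M.Γhat) (K := {x₀}) (x := (M.planOf q).states)
    (M.planOf_feasible hq).states_mem t

/-- Total utility is upper semicontinuous on the compact set of programs, and maximizing it there
suffices. -/
theorem exists_optimalEquilibrium {N : State → ℝ} {b : ℝ → ℕ → ℝ}
    (R : Regular M.Γhat M.Fhat M.β N b) (x₀ : State) : ∃ P, M.OptimalEquilibrium x₀ P := by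
  have hU := M.continuous_U R.continuousOn
  have husc : UpperSemicontinuousOn (fun q => total M.β (M.utilities (M.planOf q)))
      (M.programs x₀) := by
    refine upperSemicontinuousOn_total R.β_pos (r := fun t q => M.utilities (M.planOf q) t)
      (fun t => Continuous.continuousOn ?_) (R.summable (N x₀))
      fun t q hq => (M.planOf_feasible hq).utility_le_bound R t
    exact hU.comp (continuous_real_toNNReal.comp (M.continuous_netOutput.comp
      (f := fun q : ℕ → ℝ≥0 × State => ((q t).1, (q t).2, (q (t + 1)).2)) (by fun_prop)))
  obtain ⟨q, hq, hmax⟩ := husc.exists_isMaxOn (M.programs_nonempty x₀) (M.isCompact_programs R x₀)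
  refine ⟨M.planOf q, M.planOf_feasible hq, fun Q hQ => ?_⟩
  obtain ⟨p, hp, hle⟩ := M.exists_program hQ
  exact (total_mono R.β_pos.le hle).trans (hmax hp)

/-- Since the value function is continuous, it can serve as its own minorant in `A7`. -/
theorem A7_of_continuous {N : State → ℝ} {b : ℝ → ℕ → ℝ}
    (R : Regular M.Γhat M.Fhat M.β N b) (hV : Continuous (value M.Γhat M.Fhat M.β))
    (hθ : M.θ ≤ 0) : A7 M.Γhat M.Fhat M.β where
  zero := by
    have h0 : ∀ a : ℝ≥0, (a : ℝ) ≤ 0 ↔ a = 0 := fun a => by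
      rw [← NNReal.coe_zero, NNReal.coe_le_coe, nonpos_iff_eq_zero]
    ext y
    simp only [Γhat, Set.mem_ofPred_eq, Prod.fst_zero, Prod.snd_zero, NNReal.coe_zero,
      Real.zero_rpow M.α_pos.ne', mul_zero, zero_mul, add_zero, zero_div, h0,
      Set.mem_singleton_iff, Prod.ext_iff]
  return_zero := by
    rw [M.Fhat_of_fst_eq_zero (x := 0) (y := 0) rfl, M.U_zero_of_nonpos hθ]
  minorant := ⟨_, hV, R.value_ne_top, fun _ => le_rfl, fun _ _ hx => R.tendsto_value hx⟩

end LucasUzawa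

theorem proposition4 (M : LucasUzawa)
    (N : State → ℝ) (hN : Continuous N) (hN_nonneg : ∀ x, 0 ≤ N x) (ζ ζ' : ℝ)
    (hA1 : DynProg.A1 M.Γhat)
    (hA2 : DynProg.A2 M.Γhat N ζ ζ')
    (hA3 : DynProg.A3 M.Γhat M.Fhat N)
    (hA4 : DynProg.A4 M.β ζ)
    (hA5 : DynProg.A5 M.Γhat M.Fhat) :
    (M.θ ≤ 0 → DynProg.A7 M.Γhat M.Fhat M.β) ∧
    (DynProg.A7 M.Γhat M.Fhat M.β ∨ 0 < M.θ → M.Conclusions) := by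
  obtain ⟨b, R⟩ := DynProg.exists_regular M.β_pos M.β_lt_one hN hA1 hA2 hA3 hA4 hA5
  have hV := R.value_continuous (M.value_lowerSemicontinuous R)
  refine ⟨M.A7_of_continuous R hV, fun _ => ?_⟩
  exact
    { sumExists := fun x₀ P hP =>
        DynProg.sumExists_of_le R.β_pos.le (R.summable _) (hP.utility_le_bound R)
      exists_equilibrium := M.exists_optimalEquilibrium R
      solvable := R.solvable
      bellman := R.bellmanCharacterization
      continuity := DynProg.valueContinuity_of_continuous hV }
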